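/- Let $X$ be a compact connected Riemann surface, $L$ a holomorphic line bundle on $X$ of degree $d_L$, and let $n\ge 1$ and $d$ be integers with $d\le \frac n2 d_L$. An $L$-quadric bundle of type $(n,d)$ is a pair $(V,\gamma)$ consisting of a holomorphic vector bundle $V$ on $X$ of rank $n$ and degree $d$ and a nonzero holomorphic section $\gamma$ of $S^2V^*\otimes L$, regarded as a symmetric map $\gamma:V\to V^*\otimes L$. For a subbundle $V'\subseteq V$ let $V'^\perp\subseteq V^*$ be the kernel of $V^*\to V'^*$. For $\alpha\in\mathbb R$, $(V,\gamma)$ is $\alpha$-semistable if $\alpha\le d/n$ and: 1. for every holomorphic subbundle $0\subsetneq V'\subsetneq V$: (a) if $\gamma(V')\not\subseteq V'^\perp\otimes L$, then $\deg V'\le d+\alpha(\operatorname{rk}V'-n)$; (b) if $\gamma(V')\subseteq V'^\perp\otimes L$, then $\deg V'\le \frac d2+\alpha(\operatorname{rk}V'-\frac n2)$; (c) if $\gamma(V')=0$, then $\deg V'\le \alpha\operatorname{rk}V'$; 2. for every strict filtration $0\subsetneq V'\subsetneq V''\subsetneq V$ by holomorphic subbundles with $\gamma(V')\subseteq V''^\perp\otimes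 L$ and $\gamma(V'')\not\subseteq V''^\perp\otimes L$, one has $\deg V'+\deg V''\le d+\alpha(\operatorname{rk}V'+\operatorname{rk}V''-n)$. A real number $\alpha_c\le d/n$ is called a critical value (for type $(n,d)$) if either $\alpha_c=d/n$, or there is an $\alpha_c$-semistable $L$-quadric bundle of type $(n,d)$ for which equality holds in one of the inequalities (1)(a), (1)(b), (1)(c), (2) with $\alpha=\alpha_c$, the coefficient of $\alpha$ in that equality being nonzero (that is, $\operatorname{rk}V'\ne n/2$ in case (1)(b) and $\operatorname{rk}V'+\operatorname{rk}V''\ne n$ in case (2)). Equivalently, $\alpha_c$ then equals $$\frac{d-\deg V'}{n-\operatorname{rk}V'},\quad \frac{d-2\deg V'}{n-2\operatorname{rk}V'},\quad \frac{\deg V'}{\operatorname{rk}V'}\quad\text{or}\quad \frac{d-\deg V'-\deg V''}{n-\operatorname{rk}V'-\operatorname{rk}V''}$$ for such a $V'$ or such a filtration. **Proposition.** If $\alpha_c$ is a critical value, then $\alpha_m\le\alpha_c\le\alpha_M$, where $$\alpha_m=d-\frac{n-1}{2}\,d_L\qquad\text{and}\qquad \alpha_M=\frac dn .$$ -/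

import Mathlib

open scoped Manifold ContDiff Topology ComplexConjugate
open Bundle

noncomputable section

/-! ### Complex one-dimensional manifolds as real surfaces -/

/-- A map that is holomorphic near a point of a complex one-dimensional manifold is smooth there in
the real sense. -/
theorem ContMDiffAt.real_of_complex {X : Type*} [TopologicalSpace X] [ChartedSpace ℂ X]
    {F : Type*} [NormedAddCommGroup F] [NormedSpace ℂ F] {f : X → F} {x : X}
    (hf : ContMDiffAt 𝓘(ℂ) 𝓘(ℂ, F) ω f x) :
    ContMDiffAt 𝓘(ℝ, ℂ) 𝓘(ℝ, F) ∞ f x := by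
  rw [contMDiffAt_iff] at hf ⊢
  refine ⟨hf.1, ?_⟩
  have := (hf.2.restrict_scalars ℝ).of_le (m := ∞) le_top
  simpa using this

/-- The real smooth structure underlying a complex one-dimensional manifold. -/
theorem IsManifold.real_of_complex (X : Type*) [TopologicalSpace X] [ChartedSpace ℂ X]
    [IsManifold 𝓘(ℂ) ω X] : IsManifold 𝓘(ℝ, ℂ) ∞ X := by
  apply isManifold_of_contDiffOn
  intro e e' he he'
  have h1 := ((contDiffGroupoid ω 𝓘(ℂ)).compatible he he').1
  have h2 : ContDiffOn ℂ ω (e.symm ≫ₕ e') (e.symm ≫ₕ e').source := by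
    simpa [contDiffPregroupoid] using h1
  simpa using (h2.restrict_scalars ℝ).of_le (m := ∞) le_top

section Surface

variable (X : Type*) [TopologicalSpace X] [T2Space X] [CompactSpace X] [ChartedSpace ℂ X]
  [IsManifold 𝓘(ℂ) ω X]

theorem exists_chartPartition :
    ∃ ρ : SmoothPartitionOfUnity X 𝓘(ℝ, ℂ) X Set.univ,
      ρ.IsSubordinate fun x => (chartAt ℂ x).source := by
  have := IsManifold.real_of_complex X
  exact SmoothPartitionOfUnity.exists_isSubordinate_chartAt_source 𝓘(ℝ, ℂ) X

/-- A smooth partition of unity on a compact Riemann surface, subordinate to the domains of the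
holomorphic charts `chartAt ℂ p`, `p ∈ X`. -/
def chartPartition : SmoothPartitionOfUnity X 𝓘(ℝ, ℂ) X Set.univ :=
  (exists_chartPartition X).choose

variable {X}

/-- The integral over a compact Riemann surface of the real 2-form which, in the coordinate
`z = x + iy` given by the chart at `p`, is `a p z dx ∧ dy`: the 2-form is cut into pieces by a
partition of unity subordinate to the charts, and each piece is integrated in its chart. -/
def surfaceIntegral (a : X → ℂ → ℝ) : ℝ :=
  ∑ᶠ p : X, ∫ z in (chartAt ℂ p).target, chartPartition X p ((chartAt ℂ p).symm z) * a p z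

end Surface

/-! ### Holomorphic vector bundles -/

section Bundles

variable (X : Type*) [TopologicalSpace X] [ChartedSpace ℂ X]

/-- A holomorphic vector bundle of rank `n` over a Riemann surface `X`. -/
structure HolVectorBundle (n : ℕ) where
  /-- the fibre over a point -/
  Fiber : X → Type
  [addCommGroup : ∀ x, AddCommGroup (Fiber x)]
  [module : ∀ x, Module ℂ (Fiber x)]
  [topFiber : ∀ x, TopologicalSpace (Fiber x)]
  [topTotal : TopologicalSpace (TotalSpace (EuclideanSpace ℂ (Fin n)) Fiber)]
  [fiberBundle : FiberBundle (EuclideanSpace ℂ (Fin n)) Fiber]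
  [vectorBundle : VectorBundle ℂ (EuclideanSpace ℂ (Fin n)) Fiber]
  [holomorphic : ContMDiffVectorBundle ω (EuclideanSpace ℂ (Fin n)) Fiber 𝓘(ℂ)]

attribute [instance] HolVectorBundle.addCommGroup HolVectorBundle.module
  HolVectorBundle.topFiber HolVectorBundle.topTotal HolVectorBundle.fiberBundle
  HolVectorBundle.vectorBundle HolVectorBundle.holomorphic

variable {X} {n : ℕ}

/-- `s` is a holomorphic section of `V` over the (open) set `U`. -/
def HolVectorBundle.IsHolSection (V : HolVectorBundle X n) (s : ∀ x, V.Fiber x) (U : Set X) :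
    Prop :=
  ContMDiffOn 𝓘(ℂ) (𝓘(ℂ).prod 𝓘(ℂ, EuclideanSpace ℂ (Fin n))) ω
    (fun x => (⟨x, s x⟩ : TotalSpace (EuclideanSpace ℂ (Fin n)) V.Fiber)) U

/-- A holomorphic frame over an open set `U` of a family `W` of subspaces of the fibres of `V`:
holomorphic sections of `V` over `U` that form a basis of `W x` for every `x ∈ U`. -/
structure HolVectorBundle.IsFrame (V : HolVectorBundle X n)
    (W : ∀ x, Submodule ℂ (V.Fiber x)) {r : ℕ} (s : Fin r → ∀ x, V.Fiber x) (U : Set X) :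
    Prop where
  isOpen : IsOpen U
  isHolSection : ∀ i, V.IsHolSection (s i) U
  linearIndependent : ∀ x ∈ U, LinearIndependent ℂ fun i => s i x
  span_eq : ∀ x ∈ U, Submodule.span ℂ (Set.range fun i => s i x) = W x

/-- A holomorphic vector subbundle of `V`: a family of subspaces of the fibres of constant
dimension, locally spanned by a holomorphic frame. -/
structure HolVectorBundle.Subbundle (V : HolVectorBundle X n) where
  /-- the fibre over a point, as a subspace of the fibre of `V` -/
  carrier : ∀ x, Submodule ℂ (V.Fiber x)
  rank : ℕ
  exists_frame : ∀ x, ∃ U, x ∈ U ∧ ∃ s : Fin rank → ∀ y, V.Fiber y, V.IsFrame carrier s U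

/-- `V` as a subbundle of itself. -/
def HolVectorBundle.whole (V : HolVectorBundle X n) : V.Subbundle where
  carrier _ := ⊤
  rank := n
  exists_frame x := by
    let e := trivializationAt (EuclideanSpace ℂ (Fin n)) V.Fiber x
    let b := (EuclideanSpace.basisFun (Fin n) ℂ).toBasis
    have h := e.isLocalFrameOn_localFrame_baseSet 𝓘(ℂ) ω b
    exact ⟨e.baseSet, FiberBundle.mem_baseSet_trivializationAt' x, e.localFrame b,
      e.open_baseSet, h.contMDiffOn, fun _ hx => h.linearIndependent hx,
      fun _ hx => top_le_iff.1 (h.generating hx)⟩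

/-- A smooth Hermitian metric on the holomorphic vector bundle `V`. -/
structure HolVectorBundle.HermitianMetric (V : HolVectorBundle X n) where
  /-- the Hermitian inner product on the fibre over a point -/
  form : ∀ x, V.Fiber x →ₗ⋆[ℂ] V.Fiber x →ₗ[ℂ] ℂ
  conj_symm : ∀ x v w, conj (form x v w) = form x w v
  pos : ∀ x v, v ≠ 0 → 0 < (form x v v).re
  smooth : ∀ (U : Set X) (s t : ∀ x, V.Fiber x), IsOpen U → V.IsHolSection s U →
    V.IsHolSection t U → ContMDiffOn 𝓘(ℝ, ℂ) 𝓘(ℝ, ℂ) ∞ (fun x => form x (s x) (t x)) U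

/-- Smooth Hermitian metrics exist. -/
instance HolVectorBundle.nonempty_hermitianMetric [T2Space X] [CompactSpace X]
    [IsManifold 𝓘(ℂ) ω X] (V : HolVectorBundle X n) : Nonempty V.HermitianMetric := by
  have := IsManifold.real_of_complex X
  let F := EuclideanSpace ℂ (Fin n)
  let T : X → Trivialization F (TotalSpace.proj : TotalSpace F V.Fiber → X) :=
    trivializationAt F V.Fiber
  obtain ⟨ρ, hρ⟩ := SmoothPartitionOfUnity.exists_isSubordinate 𝓘(ℝ, ℂ) (s := Set.univ)
    isClosed_univ (fun p => (T p).baseSet) (fun p => (T p).open_baseSet)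
    (fun x _ => Set.mem_iUnion.2 ⟨x, FiberBundle.mem_baseSet_trivializationAt' x⟩)
  let L : ∀ p x, V.Fiber x →ₗ[ℂ] F := fun p x => (T p).linearMapAt ℂ x
  let B : ∀ x, V.Fiber x → V.Fiber x → ℂ := fun x v w =>
    ∑ p ∈ ρ.finsupport x, (ρ p x : ℂ) * inner ℂ (L p x v) (L p x w)
  have hB : ∀ x v w, B x v w = ∑ᶠ p, ρ p x • inner ℂ (L p x v) (L p x w) := by
    intro x v w
    rw [finsum_eq_sum_of_support_subset (s := ρ.finsupport x)]
    · simp [B]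
    · intro p hp
      simp only [ρ.coe_finsupport, Function.mem_support] at hp ⊢
      exact fun h => hp (by simp [h])
  refine ⟨⟨fun x => LinearMap.mk₂'ₛₗ _ _ (B x) ?_ ?_ ?_ ?_, ?_, ?_, ?_⟩⟩
  · intro v v' w
    simp only [B, map_add, ← Finset.sum_add_distrib, ← mul_add]
    exact Finset.sum_congr rfl fun _ _ => by rw [inner_add_left]
  · intro c v w
    simp only [B, map_smul, smul_eq_mul, Finset.mul_sum]
    exact Finset.sum_congr rfl fun _ _ => by rw [inner_smul_left]; ring
  · intro v w w'
    simp only [B, map_add, ← Finset.sum_add_distrib, ← mul_add]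
    exact Finset.sum_congr rfl fun _ _ => by rw [inner_add_right]
  · intro c v w
    simp only [B, map_smul, smul_eq_mul, Finset.mul_sum, RingHom.id_apply]
    exact Finset.sum_congr rfl fun _ _ => by rw [inner_smul_right]; ring
  · intro x v w
    simp only [LinearMap.mk₂'ₛₗ_apply, B, map_sum, map_mul, Complex.conj_ofReal]
    exact Finset.sum_congr rfl fun _ _ => by rw [inner_conj_symm]
  · intro x v hv
    simp only [LinearMap.mk₂'ₛₗ_apply, B, Complex.re_sum, Complex.re_ofReal_mul]
    have hne : (ρ.finsupport x).Nonempty := by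
      by_contra h
      have := ρ.sum_finsupport (x₀ := x) (Set.mem_univ x)
      rw [Finset.not_nonempty_iff_eq_empty.1 h] at this
      simp at this
    refine Finset.sum_pos (fun p hp => ?_) hne
    have hp' : ρ p x ≠ 0 := by simpa using hp
    have hx : x ∈ (T p).baseSet := hρ p (subset_tsupport _ hp')
    have h0 : 0 < ρ p x := lt_of_le_of_ne (ρ.nonneg p x) (Ne.symm hp')
    refine mul_pos h0 ?_
    have hL : L p x v ≠ 0 := by
      intro h
      apply hv
      have h2 := (T p).symmₗ_linearMapAt (R := ℂ) hx v
      rw [show (T p).linearMapAt ℂ x v = 0 from h] at h2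
      simpa using h2.symm
    have := inner_self_eq_norm_sq_to_K (𝕜 := ℂ) (L p x v)
    rw [this]
    have h3 : 0 < ‖L p x v‖ := norm_pos_iff.2 hL
    simpa [← Complex.ofReal_pow] using pow_pos h3 2
  · intro U s t hU hs ht x hx
    have key : ContMDiffAt 𝓘(ℝ, ℂ) 𝓘(ℝ, ℂ) ∞
        (fun y => ∑ᶠ p, ρ p y • (inner ℂ (L p y (s y)) (L p y (t y)) : ℂ)) x := by
      refine ρ.contMDiffAt_finsum fun p hp => ?_
      have hxp : x ∈ (T p).baseSet := hρ p hp
      have aux : ∀ u : ∀ x, V.Fiber x, V.IsHolSection u U →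
          ContMDiffAt 𝓘(ℝ, ℂ) 𝓘(ℝ, F) ∞ (fun y => L p y (u y)) x := by
        intro u hu
        have h1 := (hu x hx).contMDiffAt (hU.mem_nhds hx)
        have h2 := ((T p).contMDiffAt_section_iff hxp).1 h1
        refine (ContMDiffAt.real_of_complex h2).congr_of_eventuallyEq ?_
        filter_upwards [(T p).open_baseSet.mem_nhds hxp] with y hy
        simp [L, (T p).coe_linearMapAt_of_mem hy]
      have h1 := aux s hs
      have h2 := aux t ht
      exact (contDiff_inner (𝕜 := ℂ) (E := F)).contMDiff.contMDiffAt.comp x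
        (h1.prodMk_space h2)
    refine (key.congr_of_eventuallyEq ?_).contMDiffWithinAt
    exact Filter.Eventually.of_forall fun y => by simp [hB]

/-! ### Degrees -/

/-- The Gram determinant `det (h(sᵢ, sⱼ))` at `x` of a finite family of sections. -/
def HolVectorBundle.HermitianMetric.gramDet {V : HolVectorBundle X n} (h : V.HermitianMetric)
    {r : ℕ} (s : Fin r → ∀ x, V.Fiber x) (x : X) : ℝ :=
  (Matrix.of fun i j => h.form x (s i x) (s j x)).det.re

/-- A holomorphic frame of the subbundle `W` near the point `x`. -/
def HolVectorBundle.Subbundle.frameAt {V : HolVectorBundle X n} (W : V.Subbundle) (x : X) :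
    Fin W.rank → ∀ y, V.Fiber y :=
  (W.exists_frame x).choose_spec.2.choose

/-- The first Chern form `(i/2π) tr F` of the Chern connection of `(W, h)`, written as
`chernForm h W p z dx ∧ dy` in the coordinate `z = x + iy` given by the chart at `p`. In a
holomorphic frame of `W` one has `tr F = - ∂ ∂̄ log det H` with `H` the Gram matrix of the frame, so
that the Chern form is `- (1/4π) Δ (log det H) dx ∧ dy`; changing the frame adds to `log det H`
a harmonic function, so the value does not depend on the frame. -/
def HolVectorBundle.Subbundle.chernForm {V : HolVectorBundle X n} (h : V.HermitianMetric)
    (W : V.Subbundle) (p : X) (z : ℂ) : ℝ :=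
  -(1 / (4 * Real.pi)) * Laplacian.laplacian
    (fun w : ℂ => Real.log
      (h.gramDet (W.frameAt ((chartAt ℂ p).symm z)) ((chartAt ℂ p).symm w))) z

/-- The degree of a holomorphic subbundle `W ⊆ V` over a compact Riemann surface: the integral of
its first Chern form for the restriction to `W` of a smooth Hermitian metric on `V` (any one: the
integral does not depend on it). -/
def HolVectorBundle.Subbundle.degree [T2Space X] [CompactSpace X] [IsManifold 𝓘(ℂ) ω X]
    {V : HolVectorBundle X n} (W : V.Subbundle) : ℝ :=
  surfaceIntegral (W.chernForm (Classical.choice V.nonempty_hermitianMetric))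

/-- The degree of a holomorphic vector bundle over a compact Riemann surface. -/
def HolVectorBundle.degree [T2Space X] [CompactSpace X] [IsManifold 𝓘(ℂ) ω X]
    (V : HolVectorBundle X n) : ℝ :=
  V.whole.degree

/-! ### Quadric bundles -/

/-- An `L`-quadric bundle `(V, γ)` of rank `n`: a holomorphic vector bundle `V` of rank `n` with a
nonzero holomorphic section `γ` of `S²V* ⊗ L`, that is, a holomorphic family of symmetric bilinear
forms on the fibres of `V` with values in the fibres of `L`. -/
structure QuadricBundle (L : HolVectorBundle X 1) (n : ℕ) where
  V : HolVectorBundle X n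
  γ : ∀ x, V.Fiber x →ₗ[ℂ] V.Fiber x →ₗ[ℂ] L.Fiber x
  symm : ∀ x v w, γ x v w = γ x w v
  holomorphic : ∀ (U : Set X) (s t : ∀ x, V.Fiber x), IsOpen U → V.IsHolSection s U →
    V.IsHolSection t U → L.IsHolSection (fun x => γ x (s x) (t x)) U
  ne_zero : ∃ x, γ x ≠ 0

namespace QuadricBundle

variable {L : HolVectorBundle X 1}

/-- `γ(A) ⊆ B^⊥ ⊗ L`, where `B^⊥ ⊆ V*` is the annihilator of `B`: that is, `γ(A, B) = 0`. -/
def Annihilates (Q : QuadricBundle L n) (A B : Q.V.Subbundle) : Prop :=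
  ∀ x, ∀ v ∈ A.carrier x, ∀ w ∈ B.carrier x, Q.γ x v w = 0

/-- `γ(A) = 0`. -/
def Kills (Q : QuadricBundle L n) (A : Q.V.Subbundle) : Prop :=
  ∀ x, ∀ v ∈ A.carrier x, Q.γ x v = 0

/-- `0 ⊊ A ⊊ V`. -/
def IsProper (Q : QuadricBundle L n) (A : Q.V.Subbundle) : Prop :=
  0 < A.rank ∧ A.rank < n

/-- A strict filtration `0 ⊊ A ⊊ B ⊊ V` with `γ(A) ⊆ B^⊥ ⊗ L` and `γ(B) ⊄ B^⊥ ⊗ L`. -/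
structure IsFiltration (Q : QuadricBundle L n) (A B : Q.V.Subbundle) : Prop where
  pos : 0 < A.rank
  le : ∀ x, A.carrier x ≤ B.carrier x
  lt : A.rank < B.rank
  lt_top : B.rank < n
  annihilates : Q.Annihilates A B
  not_annihilates : ¬ Q.Annihilates B B

variable [T2Space X] [CompactSpace X] [IsManifold 𝓘(ℂ) ω X]

/-- `α`-semistability of a quadric bundle. -/
structure IsSemistable (Q : QuadricBundle L n) (α : ℝ) : Prop where
  le_slope : α ≤ Q.V.degree / n
  nonisotropic : ∀ A : Q.V.Subbundle, Q.IsProper A → ¬ Q.Annihilates A A →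
    A.degree ≤ Q.V.degree + α * (A.rank - n)
  isotropic : ∀ A : Q.V.Subbundle, Q.IsProper A → Q.Annihilates A A →
    A.degree ≤ Q.V.degree / 2 + α * (A.rank - n / 2)
  kernel : ∀ A : Q.V.Subbundle, Q.IsProper A → Q.Kills A → A.degree ≤ α * A.rank
  filtration : ∀ A B : Q.V.Subbundle, Q.IsFiltration A B →
    A.degree + B.degree ≤ Q.V.degree + α * (A.rank + B.rank - n)

/-- Equality holds in one of the inequalities of the definition of `α`-semistability, in such a way
that it determines `α`: the coefficient of `α` in that equality is nonzero. The coefficient is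
automatically nonzero in the first and the third case; in the other two, a vanishing coefficient
means that the equality does not depend on `α`. -/
inductive AttainsEquality (Q : QuadricBundle L n) (α : ℝ) : Prop
  | nonisotropic (A : Q.V.Subbundle) (hA : Q.IsProper A) (hγ : ¬ Q.Annihilates A A)
      (h : A.degree = Q.V.degree + α * (A.rank - n))
  | isotropic (A : Q.V.Subbundle) (hA : Q.IsProper A) (hγ : Q.Annihilates A A)
      (hne : 2 * A.rank ≠ n) (h : A.degree = Q.V.degree / 2 + α * (A.rank - n / 2))
  | kernel (A : Q.V.Subbundle) (hA : Q.IsProper A) (hγ : Q.Kills A)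
      (h : A.degree = α * A.rank)
  | filtration (A B : Q.V.Subbundle) (hAB : Q.IsFiltration A B) (hne : A.rank + B.rank ≠ n)
      (h : A.degree + B.degree = Q.V.degree + α * (A.rank + B.rank - n))

/-- `α` is a critical value for `L`-quadric bundles of type `(n, d)`: `α ≤ d/n`, and either
`α = d/n` or some `α`-semistable quadric bundle of type `(n, d)` attains equality in one of the
semistability inequalities in a way that depends on `α`. (A strictly `α`-polystable quadric bundle
that is not so independently of `α` is of this kind.) -/
def IsCriticalValue (L : HolVectorBundle X 1) (n : ℕ) (d : ℤ) (α : ℝ) : Prop :=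
  α ≤ d / n ∧ (α = d / n ∨
    ∃ Q : QuadricBundle L n, Q.V.degree = d ∧ Q.IsSemistable α ∧ Q.AttainsEquality α)

end QuadricBundle

end Bundles

end

noncomputable section

/-! ### The Laplacian on the complex plane -/

section Plane

open Laplacian InnerProductSpace

/-! Write `l` for the degree of `L`. The hypothesis `d ≤ n l / 2` gives, for every integer `k ≥ 1`,
the identity `d - (n - k) l / 2 = k (d - (n - 1) l / 2) + (k - 1) (n l / 2 - d)`, whose last term is
nonnegative. So it suffices to find `k ≥ 1` with `k α ≥ d - (n - k) l / 2`. The value `α = d / n` is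
the case `k = n`.

If `γ` is degenerate at every point, let `R` be its kernel, of rank `k`. Semistability gives `deg R
≤ k α`, and the form that `γ` induces on `V / R` gives `2 (d - deg R) ≤ (n - k) l`; together these
are the wanted bound, whatever equality is attained. If `γ` is generically nondegenerate,
semistability forces `2 deg A ≤ (rk A) l` for the subbundles concerned, and the attained equality
turns this into the bound with `k` equal to `n - rk A`, `n - 2 rk A` or `n - rk A - rk B`. For
isotropic `A` lying in a nonisotropic `B` orthogonal to it, take the orthogonal `P` of `A`: in the
filtration inequality for `A ⊂ P` the coefficient of `α` vanishes, so `deg A + deg P ≤ d`, while the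
pairing of `A` with `V / P` gives `deg A + d - deg P ≤ (rk A) l`. A nonisotropic `A` is handled
through its radical (`two_mul_degree_le`).

Two geometric facts carry this. The first is `degree_add_degree_le`: a generically nondegenerate
pairing `A / K × B / K' → L` of rank `r` has a nonzero determinant, a section of a line bundle of
degree `r l - deg (A / K) - deg (B / K')`, so this number is nonnegative. As degrees are integrals
of Chern forms, the sign comes from analysis: the squared norm `u` of the determinant is smooth with
isolated zeros, `∂∂̄ log u` is a combination of Chern forms away from them, and `log (u + δ)` with
`δ → 0` bounds its integral by Stokes.

The second is `exists_kernel_subbundle`: the kernel of a pairing, saturated over the points where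
the rank drops, is a subbundle. Near a point, its frame comes from Cramer's rule applied to a minor
of lowest vanishing order, which makes the coefficients holomorphic. -/

theorem laplacian_eq_fderiv_fderiv (f : ℂ → ℝ) (z : ℂ) :
    Δ f z = fderiv ℝ (fderiv ℝ f) z 1 1 + fderiv ℝ (fderiv ℝ f) z Complex.I Complex.I := by
  simp [laplacian_eq_iteratedFDeriv_complexPlane, iteratedFDeriv_two_apply]

theorem ContDiffAt.differentiableAt_fderiv {f : ℂ → ℝ} {z : ℂ} (hf : ContDiffAt ℝ 2 f z) :
    DifferentiableAt ℝ (fderiv ℝ f) z :=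
  (hf.fderiv_right (m := 1) (by norm_num)).differentiableAt (by norm_num)

theorem ContDiffAt.eventually_differentiableAt {f : ℂ → ℝ} {z : ℂ} (hf : ContDiffAt ℝ 2 f z) :
    ∀ᶠ w in 𝓝 z, DifferentiableAt ℝ f w := by
  filter_upwards [hf.eventually (by simp)] with w hw
  exact hw.differentiableAt (by norm_num)

theorem ContDiffAt.continuousAt_laplacian {f : ℂ → ℝ} {z : ℂ} (hf : ContDiffAt ℝ 2 f z) :
    ContinuousAt (Δ f) z := by
  have h1 : ContDiffAt ℝ 1 (fderiv ℝ f) z := hf.fderiv_right (m := 1) (by norm_num)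
  have h2 : ContDiffAt ℝ 0 (fderiv ℝ (fderiv ℝ f)) z := h1.fderiv_right (m := 0) (by norm_num)
  have h3 := h2.continuousAt
  have : Δ f = fun z => fderiv ℝ (fderiv ℝ f) z 1 1 +
      fderiv ℝ (fderiv ℝ f) z Complex.I Complex.I := by
    funext z; exact laplacian_eq_fderiv_fderiv f z
  rw [this]
  exact ((h3.clm_apply continuousAt_const).clm_apply continuousAt_const).add
    ((h3.clm_apply continuousAt_const).clm_apply continuousAt_const)

/-- Second derivative of a composition with a function of one real variable. -/
theorem fderiv_fderiv_comp_real {F : ℝ → ℝ} {f : ℂ → ℝ} {z : ℂ} (hf : ContDiffAt ℝ 2 f z)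
    (hF : ContDiffAt ℝ 2 F (f z)) (e : ℂ) :
    fderiv ℝ (fderiv ℝ fun w => F (f w)) z e e =
      deriv F (f z) * fderiv ℝ (fderiv ℝ f) z e e +
        deriv (deriv F) (f z) * (fderiv ℝ f z e) ^ 2 := by
  have hev : ∀ᶠ w in 𝓝 z, DifferentiableAt ℝ F (f w) := by
    refine hf.continuousAt.eventually ?_
    filter_upwards [hF.eventually (by simp)] with w hw
    exact hw.differentiableAt (by norm_num)
  have h1 : (fderiv ℝ fun w => F (f w)) =ᶠ[𝓝 z] fun w => deriv F (f w) • fderiv ℝ f w := by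
    filter_upwards [hev, hf.eventually_differentiableAt] with w h1 h2
    exact (h1.hasDerivAt.comp_hasFDerivAt w h2.hasFDerivAt).fderiv
  have hF' : DifferentiableAt ℝ (deriv F) (f z) := by
    have h2 : DifferentiableAt ℝ (fderiv ℝ F) (f z) :=
      (hF.fderiv_right (m := 1) (by norm_num)).differentiableAt (by norm_num)
    have h3 : deriv F = fun t => fderiv ℝ F t 1 := by funext t; simp
    rw [h3]
    exact h2.clm_apply (differentiableAt_const _)
  have h2 : HasFDerivAt (fun w => deriv F (f w)) (deriv (deriv F) (f z) • fderiv ℝ f z) z :=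
    hF'.hasDerivAt.comp_hasFDerivAt z (hf.differentiableAt (by norm_num)).hasFDerivAt
  have h3 := h2.smul hf.differentiableAt_fderiv.hasFDerivAt
  rw [h1.fderiv_eq, show fderiv ℝ (fun w => deriv F (f w) • fderiv ℝ f w) z = _ from h3.fderiv]
  simp
  ring

/-- If `f > 0` then `log (f + δ)` is at least as subharmonic as `log f`, up to a factor. -/
theorem laplacian_log_add_ge {f : ℂ → ℝ} {z : ℂ} (hf : ContDiffAt ℝ 2 f z) (h0 : 0 < f z)
    {δ : ℝ} (hδ : 0 < δ) :
    f z / (f z + δ) * Δ (fun w => Real.log (f w)) z ≤ Δ (fun w => Real.log (f w + δ)) z := by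
  have key : ∀ c : ℝ, 0 ≤ c → ∀ e : ℂ, fderiv ℝ (fderiv ℝ fun w => Real.log (f w + c)) z e e =
      (f z + c)⁻¹ * fderiv ℝ (fderiv ℝ f) z e e - ((f z + c) ^ 2)⁻¹ * (fderiv ℝ f z e) ^ 2 := by
    intro c hc e
    have hpos : 0 < f z + c := by positivity
    have h1 : ∀ t, 0 < t + c → HasDerivAt (fun t => Real.log (t + c)) (t + c)⁻¹ t := by
      intro t ht
      simpa using ((hasDerivAt_id t).add_const c).log ht.ne'
    have h2 : deriv (fun t => Real.log (t + c)) =ᶠ[𝓝 (f z)] fun t => (t + c)⁻¹ := by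
      have : ∀ᶠ t in 𝓝 (f z), 0 < t + c :=
        (continuous_id.add continuous_const).continuousAt.eventually (lt_mem_nhds hpos)
      filter_upwards [this] with t ht using (h1 t ht).deriv
    have h3 : HasDerivAt (fun t => (t + c)⁻¹) (-((f z + c) ^ 2)⁻¹) (f z) := by
      have := ((hasDerivAt_id (f z)).add_const c).inv hpos.ne'
      convert! this using 1
      simp [div_eq_mul_inv]
    have hF : ContDiffAt ℝ 2 (fun t => Real.log (t + c)) (f z) :=
      (contDiffAt_id.add contDiffAt_const).log hpos.ne'
    rw [fderiv_fderiv_comp_real (F := fun t => Real.log (t + c)) hf hF e, (h1 _ hpos).deriv,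
      h2.deriv_eq, h3.deriv]
    ring
  have k0 : ∀ e, _ := fun e => key 0 le_rfl e
  simp only [add_zero] at k0
  rw [laplacian_eq_fderiv_fderiv, laplacian_eq_fderiv_fderiv, key δ hδ.le, key δ hδ.le, k0, k0]
  set a := fderiv ℝ (fderiv ℝ f) z 1 1
  set b := fderiv ℝ (fderiv ℝ f) z Complex.I Complex.I
  set p := fderiv ℝ f z 1
  set q := fderiv ℝ f z Complex.I
  set t := f z
  have hpos : 0 < t + δ := by positivity
  -- The second-order terms cancel, and the squared gradient is left with coefficient `1 / (t (t +
  -- δ)) - 1 / (t + δ) ^ 2 = δ / (t (t + δ) ^ 2)`.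
  have e1 : (t + δ)⁻¹ * a - ((t + δ) ^ 2)⁻¹ * p ^ 2 + ((t + δ)⁻¹ * b - ((t + δ) ^ 2)⁻¹ * q ^ 2) -
      t / (t + δ) * (t⁻¹ * a - (t ^ 2)⁻¹ * p ^ 2 + (t⁻¹ * b - (t ^ 2)⁻¹ * q ^ 2)) =
      δ / (t * (t + δ) ^ 2) * (p ^ 2 + q ^ 2) := by
    field_simp
    ring
  have : 0 ≤ δ / (t * (t + δ) ^ 2) * (p ^ 2 + q ^ 2) := by positivity
  linarith

/-- Conformal change of variables for the Laplacian. -/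
theorem laplacian_comp_analytic {f : ℂ → ℝ} {φ : ℂ → ℂ} {z : ℂ} (hφ : AnalyticAt ℂ φ z)
    (hf : ContDiffAt ℝ 2 f (φ z)) :
    Δ (fun w => f (φ w)) z = ‖deriv φ z‖ ^ 2 * Δ f (φ z) := by
  have hd : ∀ᶠ w in 𝓝 z, HasFDerivAt φ (deriv φ w • (1 : ℂ →L[ℝ] ℂ)) w := by
    filter_upwards [hφ.eventually_analyticAt] with w hw
    have := hw.differentiableAt.hasDerivAt.complexToReal_fderiv
    exact this
  have h1 : (fderiv ℝ fun w => f (φ w)) =ᶠ[𝓝 z]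
      fun w => (fderiv ℝ f (φ w)).comp (deriv φ w • (1 : ℂ →L[ℝ] ℂ)) := by
    filter_upwards [hd, hφ.continuousAt.eventually hf.eventually_differentiableAt] with w h1 h2
    exact (h2.hasFDerivAt.comp w h1).fderiv
  have h2 : HasFDerivAt (fun w => fderiv ℝ f (φ w))
      ((fderiv ℝ (fderiv ℝ f) (φ z)).comp (deriv φ z • (1 : ℂ →L[ℝ] ℂ))) z :=
    hf.differentiableAt_fderiv.hasFDerivAt.comp z hd.self_of_nhds
  have h3 : HasFDerivAt (deriv φ) (deriv (deriv φ) z • (1 : ℂ →L[ℝ] ℂ)) z :=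
    hφ.deriv.differentiableAt.hasDerivAt.complexToReal_fderiv
  have h4 : ∀ e : ℂ, fderiv ℝ (fderiv ℝ fun w => f (φ w)) z e e =
      fderiv ℝ (fderiv ℝ f) (φ z) (deriv φ z * e) (deriv φ z * e) +
        fderiv ℝ f (φ z) (deriv (deriv φ) z * e * e) := by
    intro e
    have h5 := h2.clm_comp (h3.smul_const (1 : ℂ →L[ℝ] ℂ))
    rw [h1.fderiv_eq, h5.fderiv]
    simp only [add_apply, ContinuousLinearMap.comp_apply, ContinuousLinearMap.compL_apply,
      ContinuousLinearMap.flip_apply, smul_apply, ContinuousLinearMap.smulRight_apply,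
      one_apply_eq_self]
    simp only [smul_eq_mul]
    ring
  have hsymm : ∀ v w, fderiv ℝ (fderiv ℝ f) (φ z) v w = fderiv ℝ (fderiv ℝ f) (φ z) w v :=
    fun v w => (hf.isSymmSndFDerivAt (by simp)) v w
  rw [laplacian_eq_fderiv_fderiv, laplacian_eq_fderiv_fderiv, h4, h4]
  set B := fderiv ℝ (fderiv ℝ f) (φ z)
  obtain ⟨a, b, hab⟩ : ∃ a b : ℝ, deriv φ z = a + b * Complex.I :=
    ⟨_, _, (Complex.re_add_im _).symm⟩
  have e1 : deriv φ z * 1 = a • (1 : ℂ) + b • Complex.I := by rw [hab]; simp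
  have e2 : deriv φ z * Complex.I = a • Complex.I - b • (1 : ℂ) := by
    rw [hab]; simp [add_mul, mul_assoc, sub_eq_add_neg]
  -- Since `I ^ 2 = -1`, the terms with the second derivative of `φ` cancel in the sum; the mixed
  -- second derivatives of `f` cancel by symmetry.
  have e3 : deriv (deriv φ) z * Complex.I * Complex.I = -(deriv (deriv φ) z * 1 * 1) := by
    simp [mul_assoc]
  have e4 : ‖deriv φ z‖ ^ 2 = a ^ 2 + b ^ 2 := by
    rw [hab, ← Complex.normSq_eq_norm_sq, Complex.normSq_add_mul_I]
  rw [e3, e1, e2, e4, map_neg]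
  simp only [map_add, map_sub, map_smul, add_apply, sub_apply, smul_apply, smul_eq_mul]
  rw [hsymm Complex.I 1]
  ring

theorem integral_laplacian_eq_zero {f : ℂ → ℝ} (hf : ContDiff ℝ 2 f) (hc : HasCompactSupport f) :
    ∫ z, Δ f z = 0 := by
  have h1 : ContDiff ℝ 1 (fderiv ℝ f) := hf.fderiv_right (m := 1) (by norm_num)
  have key : ∀ e : ℂ, MeasureTheory.Integrable (fun z => fderiv ℝ (fderiv ℝ f) z e e) ∧
      ∫ z, fderiv ℝ (fderiv ℝ f) z e e = 0 := by
    intro e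
    let g : ℂ → ℝ := fun z => fderiv ℝ f z e
    have hg : ContDiff ℝ 1 g := h1.clm_apply contDiff_const
    have hgc : HasCompactSupport g :=
      (hc.fderiv (𝕜 := ℝ)).comp_left (g := fun l : ℂ →L[ℝ] ℝ => l e) (by simp)
    have e1 : ∀ z, fderiv ℝ (fderiv ℝ f) z e e = fderiv ℝ g z e := by
      intro z
      have := ((h1.differentiable (by norm_num) z).hasFDerivAt.clm_apply (hasFDerivAt_const e z))
      rw [show fderiv ℝ g z = _ from this.fderiv]
      simp
    have hg' : MeasureTheory.Integrable (fun z => fderiv ℝ g z e) := by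
      refine Continuous.integrable_of_hasCompactSupport ?_ ?_
      · exact (hg.continuous_fderiv (by norm_num)).clm_apply continuous_const
      · exact (hgc.fderiv (𝕜 := ℝ)).comp_left (g := fun l : ℂ →L[ℝ] ℝ => l e) (by simp)
    simp only [e1]
    refine ⟨hg', ?_⟩
    -- Integration by parts against the constant function `1`.
    have := integral_mul_fderiv_eq_neg_fderiv_mul_of_integrable (μ := MeasureTheory.volume)
      (f := fun _ : ℂ => (1 : ℝ)) (g := g) (v := e) (by simp)
      (by simpa using hg') (by simpa using hg.continuous.integrable_of_hasCompactSupport hgc)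
      (fun x _ => differentiableAt_const _) (fun x _ => hg.differentiable (by norm_num) x)
    simpa using this
  simp only [laplacian_eq_fderiv_fderiv]
  rw [MeasureTheory.integral_add (key 1).1 (key Complex.I).1, (key 1).2, (key Complex.I).2,
    add_zero]

/-- Holomorphic factors enter Gram determinants and pairing norms through their squared modulus;
harmonicity is why they leave no trace in a Chern form. -/
theorem harmonicAt_log_normSq {f : ℂ → ℂ} {z : ℂ} (hf : AnalyticAt ℂ f z) (h0 : f z ≠ 0) :
    HarmonicAt (fun w => Real.log (Complex.normSq (f w))) z := by
  have h := (hf.harmonicAt_log_norm h0).const_smul (c := (2 : ℝ))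
  convert! h using 1
  funext w
  simp [Complex.normSq_eq_norm_sq, Real.log_pow]

/-- The Jacobian of a holomorphic coordinate change is the conformal factor by which the Laplacian
scales, so `Δ f dx ∧ dy` does not depend on the chart. -/
theorem abs_det_mul_eq_norm_sq (c : ℂ) :
    |(c • (1 : ℂ →L[ℝ] ℂ)).det| = ‖c‖ ^ 2 := by
  have h := LinearMap.det_restrictScalars (R := ℝ) (S := ℂ) (f := LinearMap.mulLeft ℂ c)
  have e : ((LinearMap.mulLeft ℂ c).restrictScalars ℝ : ℂ →ₗ[ℝ] ℂ) =
      ((c • (1 : ℂ →L[ℝ] ℂ) : ℂ →L[ℝ] ℂ) : ℂ →ₗ[ℝ] ℂ) := by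
    ext
    simp
  rw [e] at h
  rw [ContinuousLinearMap.det, h]
  simp [Complex.normSq_eq_norm_sq, Algebra.norm_complex_eq]

end Plane

/-! ### Integration on a compact Riemann surface -/

section Charts

variable {X : Type*} [TopologicalSpace X] [ChartedSpace ℂ X] [IsManifold 𝓘(ℂ) ω X]

theorem ContMDiffAt.contDiffAt_comp_chart_symm {F : Type*} [NormedAddCommGroup F]
    [NormedSpace ℝ F] {f : X → F} {p : X} {z : ℂ} (hz : z ∈ (chartAt ℂ p).target)
    (hf : ContMDiffAt 𝓘(ℝ, ℂ) 𝓘(ℝ, F) ∞ f ((chartAt ℂ p).symm z)) :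
    ContDiffAt ℝ ∞ (fun w => f ((chartAt ℂ p).symm w)) z := by
  have := IsManifold.real_of_complex X
  have h := (contMDiffOn_chart_symm (I := 𝓘(ℝ, ℂ)) (n := ∞) (x := p)).contMDiffAt
    ((chartAt ℂ p).open_target.mem_nhds hz)
  exact (hf.comp z h).contDiffAt

theorem ContMDiffAt.analyticAt_comp_chart_symm {F : Type*} [NormedAddCommGroup F]
    [NormedSpace ℂ F] [CompleteSpace F] {f : X → F} {p : X} {z : ℂ}
    (hz : z ∈ (chartAt ℂ p).target)
    (hf : ContMDiffAt 𝓘(ℂ) 𝓘(ℂ, F) ω f ((chartAt ℂ p).symm z)) :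
    AnalyticAt ℂ (fun w => f ((chartAt ℂ p).symm w)) z := by
  have h := (contMDiffOn_chart_symm (I := 𝓘(ℂ)) (n := ω) (x := p)).contMDiffAt
    ((chartAt ℂ p).open_target.mem_nhds hz)
  exact ((hf.comp z h).contDiffAt).analyticAt

theorem analyticAt_transition {p q : X} {z : ℂ} (hz : z ∈ (chartAt ℂ p).target)
    (hq : (chartAt ℂ p).symm z ∈ (chartAt ℂ q).source) :
    AnalyticAt ℂ (fun w => chartAt ℂ q ((chartAt ℂ p).symm w)) z :=
  ((contMDiffOn_chart (I := 𝓘(ℂ)) (n := ω) (x := q)).contMDiffAt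
    ((chartAt ℂ q).open_source.mem_nhds hq)).analyticAt_comp_chart_symm hz

end Charts

section Surface

open Laplacian InnerProductSpace MeasureTheory

variable {X : Type*} [TopologicalSpace X] [ChartedSpace ℂ X]

/-- The Laplacian of a function on the surface in the coordinate of the chart at `p`. -/
def chartLaplacian (f : X → ℝ) (p : X) (z : ℂ) : ℝ :=
  Δ (fun w => f ((chartAt ℂ p).symm w)) z

theorem chartLaplacian_eq_zero {f : X → ℝ} {p : X} {z : ℂ} (hz : z ∈ (chartAt ℂ p).target)
    (hf : (chartAt ℂ p).symm z ∉ tsupport f) : chartLaplacian f p z = 0 := by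
  have h : (fun w => f ((chartAt ℂ p).symm w)) =ᶠ[𝓝 z] fun _ => 0 := by
    have := ((chartAt ℂ p).symm.continuousAt hz).eventually
      ((isClosed_tsupport f).isOpen_compl.mem_nhds hf)
    filter_upwards [this] with w hw
    exact image_eq_zero_of_notMem_tsupport hw
  rw [chartLaplacian, laplacian_congr_nhds h |>.self_of_nhds]
  simp

theorem isCompact_chart_image [CompactSpace X] {s : Set X} (hs : IsClosed s) {p : X}
    (hp : s ⊆ (chartAt ℂ p).source) : IsCompact (chartAt ℂ p '' s) :=
  hs.isCompact.image_of_continuousOn ((chartAt ℂ p).continuousOn.mono hp)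

variable [IsManifold 𝓘(ℂ) ω X]

theorem continuousOn_chartLaplacian {f : X → ℝ} (hf : ContMDiff 𝓘(ℝ, ℂ) 𝓘(ℝ) ∞ f) (p : X) :
    ContinuousOn (chartLaplacian f p) (chartAt ℂ p).target := fun _ hz =>
  (((hf _).contDiffAt_comp_chart_symm hz).of_le
    ENat.LEInfty.out).continuousAt_laplacian.continuousWithinAt

/-- Supported in one chart domain, `f` extends by zero to a smooth compactly supported function on
the plane. -/
theorem integral_chartLaplacian_eq_zero [CompactSpace X] {f : X → ℝ}
    (hf : ContMDiff 𝓘(ℝ, ℂ) 𝓘(ℝ) ∞ f) {q : X} (hq : tsupport f ⊆ (chartAt ℂ q).source) :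
    ∫ z in (chartAt ℂ q).target, chartLaplacian f q z = 0 := by
  let c := chartAt ℂ q
  let K := c '' tsupport f
  have hK : IsCompact K := isCompact_chart_image (isClosed_tsupport f) hq
  have hKt : K ⊆ c.target := by
    rintro _ ⟨x, hx, rfl⟩
    exact c.map_source (hq hx)
  let G : ℂ → ℝ := c.target.indicator fun z => f (c.symm z)
  have hG1 : ∀ z ∈ c.target, G =ᶠ[𝓝 z] fun w => f (c.symm w) := fun z hz => by
    filter_upwards [c.open_target.mem_nhds hz] with w hw
    exact Set.indicator_of_mem hw _
  have hG0 : ∀ z ∉ K, G z = 0 := by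
    intro z hz
    by_cases h : z ∈ c.target
    · rw [show G z = _ from Set.indicator_of_mem h _]
      by_contra h0
      exact hz ⟨c.symm z, subset_tsupport _ h0, c.right_inv h⟩
    · exact Set.indicator_of_notMem h _
  have hG2 : ∀ z ∉ K, G =ᶠ[𝓝 z] fun _ => 0 := fun z hz => by
    filter_upwards [hK.isClosed.isOpen_compl.mem_nhds hz] with w hw using hG0 w hw
  have hGs : ContDiff ℝ 2 G := by
    refine contDiff_iff_contDiffAt.2 fun z => ?_
    by_cases hz : z ∈ c.target
    · exact (((hf _).contDiffAt_comp_chart_symm hz).of_le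
        ENat.LEInfty.out).congr_of_eventuallyEq (hG1 z hz)
    · exact contDiffAt_const.congr_of_eventuallyEq (hG2 z fun h => hz (hKt h))
  rw [← integral_laplacian_eq_zero hGs (HasCompactSupport.intro hK hG0),
    ← setIntegral_eq_integral_of_forall_compl_eq_zero (s := c.target) (f := Δ G)]
  · refine setIntegral_congr_fun c.open_target.measurableSet fun z hz => ?_
    exact (laplacian_congr_nhds (hG1 z hz)).self_of_nhds.symm
  · intro z hz
    rw [(laplacian_congr_nhds (hG2 z fun h => hz (hKt h))).self_of_nhds]
    simp

/-- The support of `ρ` confines the integrand to the chart at `p` and that of `f` to the chart at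
`q`, so both integrals live on the overlap. There the transition map is holomorphic, and its
Jacobian cancels the conformal factor of the Laplacian. -/
theorem integral_mul_chartLaplacian_change {ρ f : X → ℝ} (hf : ContMDiff 𝓘(ℝ, ℂ) 𝓘(ℝ) ∞ f)
    {p q : X} (hp : tsupport ρ ⊆ (chartAt ℂ p).source) (hq : tsupport f ⊆ (chartAt ℂ q).source) :
    ∫ z in (chartAt ℂ p).target, ρ ((chartAt ℂ p).symm z) * chartLaplacian f p z =
      ∫ z in (chartAt ℂ q).target, ρ ((chartAt ℂ q).symm z) * chartLaplacian f q z := by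
  let τ := (chartAt ℂ p).symm.trans (chartAt ℂ q)
  have hτs : τ.source ⊆ (chartAt ℂ p).target := fun z hz => by
    simp only [τ, OpenPartialHomeomorph.trans_source] at hz
    exact hz.1
  have hτt : τ.target ⊆ (chartAt ℂ q).target := fun z hz => by
    simp only [τ, OpenPartialHomeomorph.trans_target] at hz
    exact hz.1
  rw [setIntegral_eq_of_subset_of_forall_sdiff_eq_zero (s := τ.source)
    (chartAt ℂ p).open_target.measurableSet hτs,
    setIntegral_eq_of_subset_of_forall_sdiff_eq_zero (s := τ.target)
    (chartAt ℂ q).open_target.measurableSet hτt]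
  · rw [← τ.image_source_eq_target, integral_image_eq_integral_abs_det_fderiv_smul volume
      τ.open_source.measurableSet (f' := fun z => deriv τ z • (1 : ℂ →L[ℝ] ℂ)) _ τ.injOn]
    · refine setIntegral_congr_fun τ.open_source.measurableSet fun z hz => ?_
      have hz1 := hτs hz
      have hz2 : (chartAt ℂ p).symm z ∈ (chartAt ℂ q).source := by
        simp only [τ, OpenPartialHomeomorph.trans_source] at hz
        exact hz.2
      have hτz : (chartAt ℂ q).symm (τ z) = (chartAt ℂ p).symm z :=
        (chartAt ℂ q).left_inv hz2
      have h1 : (fun w => f ((chartAt ℂ p).symm w)) =ᶠ[𝓝 z]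
          fun w => (fun v => f ((chartAt ℂ q).symm v)) (τ w) := by
        filter_upwards [τ.open_source.mem_nhds hz] with w hw
        have hw2 : (chartAt ℂ p).symm w ∈ (chartAt ℂ q).source := by
          simp only [τ, OpenPartialHomeomorph.trans_source] at hw
          exact hw.2
        exact congrArg f ((chartAt ℂ q).left_inv hw2).symm
      have h2 := laplacian_comp_analytic (φ := τ) (z := z)
        (f := fun v => f ((chartAt ℂ q).symm v)) (analyticAt_transition hz1 hz2)
        (((hf _).contDiffAt_comp_chart_symm (hτt (τ.map_source hz))).of_le
          ENat.LEInfty.out)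
      have h3 : chartLaplacian f p z = ‖deriv τ z‖ ^ 2 * chartLaplacian f q (τ z) := by
        rw [chartLaplacian, (laplacian_congr_nhds h1).self_of_nhds, h2]
        rfl
      simp only [abs_det_mul_eq_norm_sq, hτz, h3, smul_eq_mul]
      ring
    · intro z hz
      have hz2 : (chartAt ℂ p).symm z ∈ (chartAt ℂ q).source := by
        simp only [τ, OpenPartialHomeomorph.trans_source] at hz
        exact hz.2
      exact ((analyticAt_transition (hτs hz) hz2).differentiableAt.hasDerivAt
        (x := z)).complexToReal_fderiv.hasFDerivWithinAt
  · intro z hz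
    have : (chartAt ℂ q).symm z ∉ tsupport ρ := fun h => hz.2 (by
      simp only [τ, OpenPartialHomeomorph.trans_target]
      exact ⟨hz.1, hp h⟩)
    rw [image_eq_zero_of_notMem_tsupport this, zero_mul]
  · intro z hz
    have : (chartAt ℂ p).symm z ∉ tsupport f := fun h => hz.2 (by
      simp only [τ, OpenPartialHomeomorph.trans_source]
      exact ⟨hz.1, hq h⟩)
    rw [chartLaplacian_eq_zero hz.1 this, mul_zero]

variable [T2Space X] [CompactSpace X]

theorem finite_support_chartPartition : {p : X | chartPartition X p ≠ 0}.Finite := by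
  have h := (chartPartition X).locallyFinite.finite_nonempty_of_compact
  refine h.subset fun p hp => ?_
  by_contra h0
  refine hp (ContMDiffMap.ext fun x => ?_)
  by_contra hx
  exact h0 ⟨x, hx⟩

variable (X) in
/-- The finitely many points whose functions in the partition of unity do not vanish. -/
def chartSupport : Finset X := (finite_support_chartPartition (X := X)).toFinset

theorem chartPartition_eq_zero {p : X} (hp : p ∉ chartSupport X) : chartPartition X p = 0 := by
  by_contra h
  exact hp ((Set.Finite.mem_toFinset _).2 h)

theorem tsupport_chartPartition_subset (p : X) :
    tsupport (chartPartition X p) ⊆ (chartAt ℂ p).source :=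
  (exists_chartPartition X).choose_spec p

theorem sum_chartPartition (x : X) : ∑ p ∈ chartSupport X, chartPartition X p x = 1 := by
  rw [← (chartPartition X).sum_eq_one (Set.mem_univ x), finsum_eq_sum_of_support_subset]
  intro p hp
  by_contra h
  exact hp (by simp [chartPartition_eq_zero h])

theorem surfaceIntegral_eq_sum (a : X → ℂ → ℝ) : surfaceIntegral a = ∑ p ∈ chartSupport X,
    ∫ z in (chartAt ℂ p).target, chartPartition X p ((chartAt ℂ p).symm z) * a p z := by
  rw [surfaceIntegral, finsum_eq_sum_of_support_subset]
  intro p hp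
  by_contra h
  refine hp ?_
  simp [chartPartition_eq_zero h]

theorem integrableOn_chartPartition_mul {p : X} {g : ℂ → ℝ}
    (hg : ContinuousOn g (chartAt ℂ p).target) :
    IntegrableOn (fun z => chartPartition X p ((chartAt ℂ p).symm z) * g z)
      (chartAt ℂ p).target := by
  let c := chartAt ℂ p
  have hs := tsupport_chartPartition_subset p
  have hK := isCompact_chart_image (isClosed_tsupport _) hs
  have hKt : c '' tsupport (chartPartition X p) ⊆ c.target := by
    rintro _ ⟨x, hx, rfl⟩
    exact c.map_source (hs hx)
  have hc : ContinuousOn (fun z => chartPartition X p (c.symm z) * g z) c.target :=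
    ((chartPartition X p).contMDiff.continuous.comp_continuousOn c.continuousOn_symm).mul hg
  refine ((hc.mono hKt).integrableOn_compact hK).of_forall_sdiff_eq_zero
    c.open_target.measurableSet fun z hz => ?_
  have : c.symm z ∉ tsupport (chartPartition X p) := fun h =>
    hz.2 ⟨_, h, c.right_inv hz.1⟩
  rw [image_eq_zero_of_notMem_tsupport this, zero_mul]

theorem surfaceIntegral_add {a b : X → ℂ → ℝ}
    (ha : ∀ p, ContinuousOn (a p) (chartAt ℂ p).target)
    (hb : ∀ p, ContinuousOn (b p) (chartAt ℂ p).target) :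
    surfaceIntegral (fun p z => a p z + b p z) = surfaceIntegral a + surfaceIntegral b := by
  simp only [surfaceIntegral_eq_sum, mul_add, ← Finset.sum_add_distrib]
  exact Finset.sum_congr rfl fun p _ => integral_add
    (integrableOn_chartPartition_mul (ha p)) (integrableOn_chartPartition_mul (hb p))

theorem surfaceIntegral_const_mul (c : ℝ) (a : X → ℂ → ℝ) :
    surfaceIntegral (fun p z => c * a p z) = c * surfaceIntegral a := by
  simp only [surfaceIntegral_eq_sum, Finset.mul_sum, mul_left_comm _ c, integral_const_mul]

/-- Stokes' theorem for the form `∂∂̄ f`. -/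
theorem surfaceIntegral_chartLaplacian {f : X → ℝ} (hf : ContMDiff 𝓘(ℝ, ℂ) 𝓘(ℝ) ∞ f) :
    surfaceIntegral (chartLaplacian f) = 0 := by
  -- The function is cut up by the same partition of unity that cuts up the integral. Each term of
  -- the resulting double sum can be moved to the chart where its piece of `f` is supported; there
  -- the weights indexed by `p` add up to `1`.
  let g : X → X → ℝ := fun q x => chartPartition X q x * f x
  have hg : ∀ q, ContMDiff 𝓘(ℝ, ℂ) 𝓘(ℝ) ∞ (g q) := fun q => (chartPartition X q).contMDiff.mul hf
  have hgs : ∀ q, tsupport (g q) ⊆ (chartAt ℂ q).source := fun q =>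
    (closure_mono (Function.support_mul_subset_left _ _)).trans (tsupport_chartPartition_subset q)
  have hsum : ∀ p, ∀ z ∈ (chartAt ℂ p).target,
      chartLaplacian f p z = ∑ q ∈ chartSupport X, chartLaplacian (g q) p z := by
    intro p z hz
    have e : (fun w => f ((chartAt ℂ p).symm w)) =
        ∑ q ∈ chartSupport X, fun w => g q ((chartAt ℂ p).symm w) := by
      funext w
      simp [g, ← Finset.sum_mul, sum_chartPartition]
    have hlin : ∀ s : Finset X, Δ (∑ q ∈ s, fun w => g q ((chartAt ℂ p).symm w)) z =
        ∑ q ∈ s, chartLaplacian (g q) p z := by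
      classical
      have hd : ∀ q, ContDiffAt ℝ 2 (fun w => g q ((chartAt ℂ p).symm w)) z := fun q =>
        ((hg q _).contDiffAt_comp_chart_symm hz).of_le ENat.LEInfty.out
      intro s
      induction s using Finset.induction_on with
      | empty =>
        simp only [Finset.sum_empty]
        exact congrFun (laplacian_const (c := (0 : ℝ))) z
      | insert q s hq ih =>
        rw [Finset.sum_insert hq, Finset.sum_insert hq, (hd q).laplacian_add, ih]
        · rfl
        · have := ContDiffAt.sum (s := s) fun q _ => hd q
          convert! this using 1
          funext w
          simp
    rw [chartLaplacian, e, hlin]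
  have h1 : surfaceIntegral (chartLaplacian f) = ∑ p ∈ chartSupport X, ∑ q ∈ chartSupport X,
      ∫ z in (chartAt ℂ q).target,
        chartPartition X p ((chartAt ℂ q).symm z) * chartLaplacian (g q) q z := by
    rw [surfaceIntegral_eq_sum]
    refine Finset.sum_congr rfl fun p _ => ?_
    rw [setIntegral_congr_fun (chartAt ℂ p).open_target.measurableSet
      (g := fun z => ∑ q ∈ chartSupport X,
        chartPartition X p ((chartAt ℂ p).symm z) * chartLaplacian (g q) p z),
      integral_finsetSum]
    · exact Finset.sum_congr rfl fun q _ => integral_mul_chartLaplacian_change (hg q)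
        (tsupport_chartPartition_subset p) (hgs q)
    · exact fun q _ => integrableOn_chartPartition_mul (continuousOn_chartLaplacian (hg q) p)
    · intro z hz
      simp only [hsum p z hz, Finset.mul_sum]
  rw [h1, Finset.sum_comm]
  refine Finset.sum_eq_zero fun q _ => ?_
  rw [← integral_finsetSum]
  · simp only [← Finset.sum_mul, sum_chartPartition, one_mul]
    exact integral_chartLaplacian_eq_zero (hg q) (hgs q)
  · intro p _
    let c := chartAt ℂ q
    have hK := isCompact_chart_image (isClosed_tsupport _) (hgs q)
    have hKt : c '' tsupport (g q) ⊆ c.target := by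
      rintro _ ⟨x, hx, rfl⟩
      exact c.map_source (hgs q hx)
    have hc : ContinuousOn (fun z => chartPartition X p (c.symm z) * chartLaplacian (g q) q z)
        c.target :=
      ((chartPartition X p).contMDiff.continuous.comp_continuousOn c.continuousOn_symm).mul
        (continuousOn_chartLaplacian (hg q) q)
    refine ((hc.mono hKt).integrableOn_compact hK).of_forall_sdiff_eq_zero
      c.open_target.measurableSet fun z hz => ?_
    rw [chartLaplacian_eq_zero hz.1 fun h => hz.2 ⟨_, h, c.right_inv hz.1⟩, mul_zero]

/-- If `u ≥ 0` is smooth with isolated zeros and `∂∂̄ log u` extends continuously over the zeros,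
then the integral of the extension is at most zero. -/
theorem surfaceIntegral_le_zero_of_laplacian_log {u : X → ℝ} (hu : ContMDiff 𝓘(ℝ, ℂ) 𝓘(ℝ) ∞ u)
    (h0 : ∀ x, 0 ≤ u x) (hz : ∀ x, ∀ᶠ y in 𝓝[≠] x, u y ≠ 0) {a : X → ℂ → ℝ}
    (ha : ∀ p, ContinuousOn (a p) (chartAt ℂ p).target)
    (hua : ∀ p, ∀ z ∈ (chartAt ℂ p).target, u ((chartAt ℂ p).symm z) ≠ 0 →
      a p z = Δ (fun w => Real.log (u ((chartAt ℂ p).symm w))) z) :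
    surfaceIntegral a ≤ 0 := by
  let δ : ℕ → ℝ := fun m => 1 / ((m : ℝ) + 1)
  have hδ : ∀ m, 0 < δ m := fun m => Nat.one_div_pos_of_nat
  let v : ℕ → X → ℝ := fun m x => Real.log (u x + δ m)
  have hv : ∀ m, ContMDiff 𝓘(ℝ, ℂ) 𝓘(ℝ) ∞ (v m) := by
    intro m x
    have h1 : ContDiffAt ℝ ∞ (fun t : ℝ => Real.log (t + δ m)) (u x) :=
      (contDiffAt_id.add contDiffAt_const).log (add_pos_of_nonneg_of_pos (h0 x) (hδ m)).ne'
    exact h1.contMDiffAt.comp x (hu x)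
  -- Off the zeros of `u` this is a lower bound for the Laplacian of `log (u + δ m)`; being written
  -- with `a`, it is continuous across them.
  let b : ℕ → X → ℂ → ℝ := fun m p z =>
    u ((chartAt ℂ p).symm z) / (u ((chartAt ℂ p).symm z) + δ m) * a p z
  have hucont : ∀ p, ContinuousOn (fun z => u ((chartAt ℂ p).symm z)) (chartAt ℂ p).target :=
    fun p => hu.continuous.comp_continuousOn (chartAt ℂ p).continuousOn_symm
  have hb : ∀ m p, ContinuousOn (b m p) (chartAt ℂ p).target := fun m p =>
    ((hucont p).div ((hucont p).add continuousOn_const)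
      (fun z _ => (add_pos_of_nonneg_of_pos (h0 _) (hδ m)).ne')).mul (ha p)
  -- Isolated zeros form a locally null, hence null, set.
  have hae : ∀ p, ∀ᵐ z ∂volume.restrict (chartAt ℂ p).target, u ((chartAt ℂ p).symm z) ≠ 0 := by
    intro p
    rw [ae_restrict_iff' (chartAt ℂ p).open_target.measurableSet]
    refine measure_null_of_locally_null _ fun z hz' => ?_
    simp only [Set.mem_compl_iff, Set.mem_ofPred_eq, Classical.not_imp, not_not] at hz'
    obtain ⟨hzt, -⟩ := hz'
    have h1 : Filter.Tendsto (chartAt ℂ p).symm (𝓝[≠] z) (𝓝[≠] ((chartAt ℂ p).symm z)) := by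
      refine tendsto_nhdsWithin_iff.2 ⟨((chartAt ℂ p).symm.continuousAt hzt).mono_left
        nhdsWithin_le_nhds, ?_⟩
      filter_upwards [self_mem_nhdsWithin, nhdsWithin_le_nhds
        ((chartAt ℂ p).open_target.mem_nhds hzt)] with w hw hwt h
      exact hw ((chartAt ℂ p).symm.injOn hwt hzt h)
    have h2 := h1.eventually (hz _)
    rw [eventually_nhdsWithin_iff] at h2
    refine ⟨_, Filter.inter_mem (nhdsWithin_le_nhds h2) self_mem_nhdsWithin,
      measure_mono_null (t := {z}) (fun w hw => ?_) (by simp)⟩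
    by_contra h
    exact hw.2 fun _ => hw.1 h
  have hle : ∀ m, surfaceIntegral (b m) ≤ 0 := by
    intro m
    rw [← surfaceIntegral_chartLaplacian (hv m), surfaceIntegral_eq_sum, surfaceIntegral_eq_sum]
    refine Finset.sum_le_sum fun p _ => ?_
    refine integral_mono_ae (integrableOn_chartPartition_mul (hb m p))
      (integrableOn_chartPartition_mul (continuousOn_chartLaplacian (hv m) p)) ?_
    filter_upwards [hae p, ae_restrict_mem (chartAt ℂ p).open_target.measurableSet] with z hz hzt
    refine mul_le_mul_of_nonneg_left ?_ ((chartPartition X).nonneg p _)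
    have h1 := laplacian_log_add_ge (((hu _).contDiffAt_comp_chart_symm hzt).of_le
      ENat.LEInfty.out) (lt_of_le_of_ne (h0 _) hz.symm) (hδ m)
    rw [← hua p z hzt hz] at h1
    exact h1
  have hlim : Filter.Tendsto (fun m => surfaceIntegral (b m)) Filter.atTop
      (𝓝 (surfaceIntegral a)) := by
    simp only [surfaceIntegral_eq_sum]
    refine tendsto_finsetSum _ fun p _ => ?_
    -- The factor `u / (u + δ m)` lies in `[0, 1]` and tends to `1` off the zeros of `u`.
    refine tendsto_integral_of_dominated_convergence
      (fun z => ‖chartPartition X p ((chartAt ℂ p).symm z) * a p z‖)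
      (fun m => (integrableOn_chartPartition_mul (hb m p)).1)
      (integrableOn_chartPartition_mul (ha p)).norm ?_ ?_
    · refine fun m => Filter.Eventually.of_forall fun z => ?_
      have h1 := h0 ((chartAt ℂ p).symm z)
      have h2 := hδ m
      simp only [b, norm_mul]
      refine mul_le_mul_of_nonneg_left ?_ (norm_nonneg _)
      refine mul_le_of_le_one_left (norm_nonneg _) ?_
      rw [Real.norm_of_nonneg (by positivity)]
      exact div_le_one_of_le₀ (by linarith) (by positivity)
    · filter_upwards [hae p] with z hz
      have h1 : Filter.Tendsto (fun m => u ((chartAt ℂ p).symm z) /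
          (u ((chartAt ℂ p).symm z) + δ m)) Filter.atTop (𝓝 1) := by
        have := (tendsto_const_nhds (x := u ((chartAt ℂ p).symm z))).div
          ((tendsto_const_nhds (x := u ((chartAt ℂ p).symm z))).add
            tendsto_one_div_add_atTop_nhds_zero_nat) (by simpa using hz)
        rw [add_zero, div_self hz] at this
        exact this
      simpa using (h1.mul_const (a p z)).const_mul _
  exact le_of_tendsto' hlim hle

end Surface

/-! ### Gram determinants -/

section Gram

variable {W : Type*} [AddCommGroup W] [Module ℂ W] {ι κ : Type*} [Fintype ι] [DecidableEq ι]
  [Fintype κ] [DecidableEq κ]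

/-- The Gram determinant of a finite family of vectors. -/
def gramDetOf (B : W →ₗ⋆[ℂ] W →ₗ[ℂ] ℂ) (s : ι → W) : ℝ :=
  (Matrix.of fun i j => B (s i) (s j)).det.re

theorem gramDetOf_comp_equiv (B : W →ₗ⋆[ℂ] W →ₗ[ℂ] ℂ) (s : ι → W) (e : κ ≃ ι) :
    gramDetOf B (s ∘ e) = gramDetOf B s := by
  rw [gramDetOf, gramDetOf, ← Matrix.det_submatrix_equiv_self e]
  rfl

/-- The Gram matrix transforms by the conjugate of `g` on the left and the transpose of `g` on the
right, because the form is sesquilinear. -/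
theorem gramDetOf_eq_normSq_mul (B : W →ₗ⋆[ℂ] W →ₗ[ℂ] ℂ) {s t : ι → W} (g : Matrix ι ι ℂ)
    (h : ∀ i, s i = ∑ j, g i j • t j) :
    gramDetOf B s = Complex.normSq g.det * gramDetOf B t := by
  have e : (Matrix.of fun i j => B (s i) (s j)) =
      g.map (starRingEnd ℂ) * (Matrix.of fun i j => B (t i) (t j)) * g.transpose := by
    ext i j
    simp only [Matrix.of_apply, h, map_sum, LinearMap.map_smulₛₗ, LinearMap.sum_apply,
      LinearMap.smul_apply, Matrix.mul_apply, Matrix.map_apply, Matrix.transpose_apply,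
      smul_eq_mul, map_smul, Finset.sum_mul]
    refine Finset.sum_congr rfl fun k _ => ?_
    rw [Finset.mul_sum]
    exact Finset.sum_congr rfl fun l _ => by ring
  have hd : (g.map (starRingEnd ℂ)).det = conj g.det :=
    ((starRingEnd ℂ).map_det g).symm
  rw [gramDetOf, e, Matrix.det_mul, Matrix.det_mul, Matrix.det_transpose, hd, mul_right_comm,
    mul_comm (conj _), Complex.mul_conj, Complex.re_ofReal_mul, gramDetOf]

open scoped ComplexOrder in
theorem gramDetOf_pos {B : W →ₗ⋆[ℂ] W →ₗ[ℂ] ℂ} (hB : ∀ v w, conj (B v w) = B w v)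
    (hpos : ∀ v, v ≠ 0 → 0 < (B v v).re) {s : ι → W} (hs : LinearIndependent ℂ s) :
    0 < gramDetOf B s := by
  have hp : (Matrix.of fun i j => B (s i) (s j)).PosDef := by
    refine Matrix.PosDef.of_dotProduct_mulVec_pos ?_ fun x hx => ?_
    · ext i j
      simp [Matrix.conjTranspose_apply, hB]
    · have e : dotProduct (star x) (Matrix.mulVec (Matrix.of fun i j => B (s i) (s j)) x) =
          B (∑ i, x i • s i) (∑ i, x i • s i) := by
        simp only [dotProduct, Matrix.mulVec, Pi.star_apply, Matrix.of_apply, map_sum,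
          LinearMap.map_smulₛₗ, LinearMap.sum_apply, LinearMap.smul_apply, smul_eq_mul,
          Finset.mul_sum, RCLike.star_def, RingHom.id_apply]
        rw [Finset.sum_comm]
        refine Finset.sum_congr rfl fun k _ => Finset.sum_congr rfl fun l _ => ?_
        ring
      have hne : (∑ i, x i • s i) ≠ 0 := fun h =>
        hx (funext (Fintype.linearIndependent_iff.1 hs x h))
      rw [e, Complex.lt_def]
      refine ⟨hpos _ hne, ?_⟩
      have := congrArg Complex.im (hB (∑ i, x i • s i) (∑ i, x i • s i))
      simp only [Complex.conj_im] at this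
      simp only [Complex.zero_im]
      linarith
  exact (Complex.lt_def.1 hp.det_pos).1

/-- Extracting a basis by choosing indices, not new vectors, is what yields minors from ranks and
keeps the members of a chosen local frame holomorphic. -/
theorem exists_comp_basis_of_span {κ : Type*} [Finite κ] {v : κ → W} {s : Submodule ℂ W}
    (hv : Submodule.span ℂ (Set.range v) = s) {r : ℕ} (hr : Module.finrank ℂ s = r) :
    ∃ f : Fin r → κ, LinearIndependent ℂ (v ∘ f) ∧
      Submodule.span ℂ (Set.range (v ∘ f)) = s := by
  obtain ⟨ι', a, ha, hsp, hli⟩ := exists_linearIndependent' ℂ v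
  have : Finite ι' := Finite.of_injective a ha
  have := Fintype.ofFinite ι'
  have hc : Fintype.card ι' = r := by
    rw [← hr, ← hv, ← hsp, finrank_span_eq_card hli]
  let e := (Fintype.equivFinOfCardEq hc).symm
  refine ⟨a ∘ e, hli.comp e e.injective, ?_⟩
  rw [← hv, ← hsp, ← Function.comp_assoc, e.surjective.range_comp]

/-- Linearly independent vectors have a nonzero maximal minor. -/
theorem exists_minor_ne_zero {n : ℕ} {v : ι → EuclideanSpace ℂ (Fin n)}
    (hv : LinearIndependent ℂ v) :
    ∃ I : ι → Fin n, (Matrix.of fun i j => v i (I j)).det ≠ 0 := by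
  let M : Matrix ι (Fin n) ℂ := Matrix.of fun i j => v i j
  have hM : LinearIndependent ℂ M.row :=
    hv.map' (WithLp.linearEquiv 2 ℂ (Fin n → ℂ)).toLinearMap (LinearEquiv.ker _)
  have hr : Module.finrank ℂ (Submodule.span ℂ (Set.range M.col)) = Fintype.card ι := by
    rw [← M.rank_eq_finrank_span_cols, hM.rank_matrix]
  obtain ⟨f, hf, -⟩ := exists_comp_basis_of_span rfl hr
  let e := Fintype.equivFin ι
  refine ⟨f ∘ e, ?_⟩
  have h2 : LinearIndependent ℂ (Matrix.of fun i j => v i ((f ∘ e) j)).col :=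
    hf.comp e e.injective
  rw [Matrix.linearIndependent_cols_iff_isUnit, Matrix.isUnit_iff_isUnit_det] at h2
  exact h2.ne_zero

end Gram

/-! ### Holomorphic sections and frames -/

section Sections

/-- The base field and the algebra of entries are kept apart so that one statement covers
holomorphic determinants and complex-valued determinants that are smooth only over the reals. -/
theorem ContMDiffAt.matrix_det {𝕜 : Type*} [NontriviallyNormedField 𝕜] {A : Type*}
    [NormedCommRing A] [NormedAlgebra 𝕜 A] {E H M : Type*} [NormedAddCommGroup E]
    [NormedSpace 𝕜 E] [TopologicalSpace H] {I : ModelWithCorners 𝕜 E H} [TopologicalSpace M]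
    [ChartedSpace H M] {m : WithTop ℕ∞} {ι : Type*} [Fintype ι] [DecidableEq ι]
    {f : ι → ι → M → A} {x : M}
    (hf : ∀ i j, ContMDiffAt I 𝓘(𝕜, A) m (f i j) x) :
    ContMDiffAt I 𝓘(𝕜, A) m (fun y => (Matrix.of fun i j => f i j y).det) x := by
  have h1 : ContDiff 𝕜 m (fun M : ι → ι → A => (Matrix.of M).det) := by
    simp only [Matrix.det_apply, Matrix.of_apply]
    refine ContDiff.sum fun σ _ => ContDiff.const_smul _ ?_
    refine contDiff_prod fun i _ => ?_
    exact contDiff_apply_apply 𝕜 A (σ i) i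
  have h2 : ContMDiffAt I 𝓘(𝕜, ι → ι → A) m (fun y i j => f i j y) x :=
    contMDiffAt_pi_space.2 fun i => contMDiffAt_pi_space.2 fun j => hf i j
  exact h1.contMDiff.contMDiffAt.comp x h2

namespace HolVectorBundle

variable {X : Type*} [TopologicalSpace X] [ChartedSpace ℂ X] {n : ℕ} {V : HolVectorBundle X n}

theorem IsHolSection.mono {s : ∀ x, V.Fiber x} {U U' : Set X} (hs : V.IsHolSection s U)
    (h : U' ⊆ U) : V.IsHolSection s U' :=
  ContMDiffOn.mono hs h

theorem IsHolSection.add {s t : ∀ x, V.Fiber x} {U : Set X} (hs : V.IsHolSection s U)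
    (ht : V.IsHolSection t U) : V.IsHolSection (fun x => s x + t x) U :=
  ContMDiffOn.add_section hs ht

theorem IsHolSection.smul {f : X → ℂ} {s : ∀ x, V.Fiber x} {U : Set X}
    (hf : ContMDiffOn 𝓘(ℂ) 𝓘(ℂ) ω f U) (hs : V.IsHolSection s U) :
    V.IsHolSection (fun x => f x • s x) U :=
  ContMDiffOn.smul_section hf hs

theorem IsHolSection.sum {ι : Type*} {F : Finset ι} {s : ι → ∀ x, V.Fiber x} {U : Set X}
    (hs : ∀ i, V.IsHolSection (s i) U) : V.IsHolSection (fun x => ∑ i ∈ F, s i x) U :=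
  ContMDiffOn.sum_section fun i _ => hs i

theorem isHolSection_zero (U : Set X) : V.IsHolSection (fun _ => 0) U := by
  have := IsHolSection.sum (V := V) (F := (∅ : Finset Empty)) (s := fun i => i.elim) (U := U)
    (fun i => i.elim)
  simpa using this

variable (V) in
/-- The domain of the preferred trivialization at `x₀`. -/
def coordNhd (x₀ : X) : Set X :=
  (trivializationAt (EuclideanSpace ℂ (Fin n)) V.Fiber x₀).baseSet

variable (V) in
/-- The fibre coordinates of the preferred trivialization at `x₀`. -/
def coord (x₀ y : X) : V.Fiber y →ₗ[ℂ] EuclideanSpace ℂ (Fin n) :=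
  (trivializationAt (EuclideanSpace ℂ (Fin n)) V.Fiber x₀).linearMapAt ℂ y

theorem isOpen_coordNhd (x₀ : X) : IsOpen (V.coordNhd x₀) :=
  (trivializationAt (EuclideanSpace ℂ (Fin n)) V.Fiber x₀).open_baseSet

theorem mem_coordNhd (x₀ : X) : x₀ ∈ V.coordNhd x₀ :=
  FiberBundle.mem_baseSet_trivializationAt' x₀

theorem coord_bijective {x₀ y : X} (hy : y ∈ V.coordNhd x₀) :
    Function.Bijective (V.coord x₀ y) := by
  rw [coord, Trivialization.linearMapAt_def_of_mem _ hy]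
  exact LinearEquiv.bijective _

theorem ker_coord {x₀ y : X} (hy : y ∈ V.coordNhd x₀) : LinearMap.ker (V.coord x₀ y) = ⊥ :=
  LinearMap.ker_eq_bot.2 (coord_bijective hy).1

instance (V : HolVectorBundle X n) (x : X) : FiniteDimensional ℂ (V.Fiber x) :=
  (LinearEquiv.ofBijective _ (coord_bijective (V := V) (mem_coordNhd x))).symm.finiteDimensional

theorem IsHolSection.contMDiffAt_coord {s : ∀ x, V.Fiber x} {U : Set X}
    (hs : V.IsHolSection s U) (hU : IsOpen U) {x₀ y : X} (hy : y ∈ U) (hy' : y ∈ V.coordNhd x₀) :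
    ContMDiffAt 𝓘(ℂ) 𝓘(ℂ, EuclideanSpace ℂ (Fin n)) ω (fun x => V.coord x₀ x (s x)) y := by
  have h1 := (hs y hy).contMDiffAt (hU.mem_nhds hy)
  have h2 := ((trivializationAt (EuclideanSpace ℂ (Fin n)) V.Fiber x₀).contMDiffAt_section_iff
    hy').1 h1
  refine h2.congr_of_eventuallyEq ?_
  filter_upwards [(isOpen_coordNhd x₀).mem_nhds hy'] with x hx
  rw [coord, Trivialization.coe_linearMapAt_of_mem _ hx]

theorem IsHolSection.contMDiffAt_coord_apply {s : ∀ x, V.Fiber x} {U : Set X}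
    (hs : V.IsHolSection s U) (hU : IsOpen U) {x₀ y : X} (hy : y ∈ U) (hy' : y ∈ V.coordNhd x₀)
    (i : Fin n) : ContMDiffAt 𝓘(ℂ) 𝓘(ℂ) ω (fun x => V.coord x₀ x (s x) i) y := by
  have h : ContDiff ℂ ω (fun v : EuclideanSpace ℂ (Fin n) => v i) :=
    (EuclideanSpace.proj (𝕜 := ℂ) i).contDiff
  exact h.contMDiff.contMDiffAt.comp y (hs.contMDiffAt_coord hU hy hy')

/-- Linear independence of holomorphic sections is an open condition. -/
theorem eventually_linearIndependent {ι : Type*} [Finite ι] {s : ι → ∀ x, V.Fiber x} {U : Set X}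
    (hU : IsOpen U) (hs : ∀ i, V.IsHolSection (s i) U) {x : X} (hx : x ∈ U)
    (hli : LinearIndependent ℂ fun i => s i x) :
    ∀ᶠ y in 𝓝 x, LinearIndependent ℂ fun i => s i y := by
  have hc : ContinuousAt (fun y i => V.coord x y (s i y)) x :=
    continuousAt_pi.2 fun i => ((hs i).contMDiffAt_coord hU hx (mem_coordNhd x)).continuousAt
  have h0 : LinearIndependent ℂ fun i => V.coord x x (s i x) :=
    hli.map' (V.coord x x) (ker_coord (mem_coordNhd x))
  filter_upwards [hc.eventually (isOpen_setOfPred_linearIndependent.mem_nhds h0)] with y hy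
  exact LinearIndependent.of_comp (V.coord x y) hy

/-- A holomorphic frame, indexed by any finite type, of a family of subspaces. -/
structure IsLocalFrame (V : HolVectorBundle X n) (W : ∀ x, Submodule ℂ (V.Fiber x)) {ι : Type*}
    (s : ι → ∀ x, V.Fiber x) (U : Set X) : Prop where
  isOpen : IsOpen U
  isHolSection : ∀ i, V.IsHolSection (s i) U
  linearIndependent : ∀ x ∈ U, LinearIndependent ℂ fun i => s i x
  span_eq : ∀ x ∈ U, Submodule.span ℂ (Set.range fun i => s i x) = W x

theorem IsFrame.isLocalFrame {W : ∀ x, Submodule ℂ (V.Fiber x)} {r : ℕ}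
    {s : Fin r → ∀ x, V.Fiber x} {U : Set X} (h : V.IsFrame W s U) : V.IsLocalFrame W s U :=
  ⟨h.isOpen, h.isHolSection, h.linearIndependent, h.span_eq⟩

theorem IsLocalFrame.mono {W : ∀ x, Submodule ℂ (V.Fiber x)} {ι : Type*}
    {s : ι → ∀ x, V.Fiber x} {U U' : Set X} (h : V.IsLocalFrame W s U) (hU' : IsOpen U')
    (hU : U' ⊆ U) : V.IsLocalFrame W s U' :=
  ⟨hU', fun i => (h.isHolSection i).mono hU, fun x hx => h.linearIndependent x (hU hx),
    fun x hx => h.span_eq x (hU hx)⟩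

theorem IsLocalFrame.comp_equiv {W : ∀ x, Submodule ℂ (V.Fiber x)} {ι κ : Type*}
    {s : ι → ∀ x, V.Fiber x} {U : Set X} (h : V.IsLocalFrame W s U) (e : κ ≃ ι) :
    V.IsLocalFrame W (s ∘ e) U :=
  ⟨h.isOpen, fun i => h.isHolSection (e i),
    fun x hx => (h.linearIndependent x hx).comp e e.injective, fun x hx => by
      rw [← h.span_eq x hx]
      exact congrArg _ (e.surjective.range_comp fun i => s i x)⟩

theorem IsLocalFrame.mem {W : ∀ x, Submodule ℂ (V.Fiber x)} {ι : Type*}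
    {s : ι → ∀ x, V.Fiber x} {U : Set X} (h : V.IsLocalFrame W s U) {x : X} (hx : x ∈ U) (i : ι) :
    s i x ∈ W x := by
  rw [← h.span_eq x hx]
  exact Submodule.subset_span ⟨i, rfl⟩

theorem Subbundle.isLocalFrame_frameAt (W : V.Subbundle) (x : X) :
    ∃ U, x ∈ U ∧ V.IsLocalFrame W.carrier (W.frameAt x) U :=
  ⟨_, (W.exists_frame x).choose_spec.1, (W.exists_frame x).choose_spec.2.choose_spec.isLocalFrame⟩

theorem Subbundle.finrank_carrier (W : V.Subbundle) (x : X) :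
    Module.finrank ℂ (W.carrier x) = W.rank := by
  obtain ⟨U, hx, h⟩ := W.isLocalFrame_frameAt x
  rw [← h.span_eq x hx, finrank_span_eq_card (h.linearIndependent x hx), Fintype.card_fin]

theorem IsLocalFrame.card_eq {W : V.Subbundle} {ι : Type*} [Fintype ι]
    {s : ι → ∀ x, V.Fiber x} {U : Set X} (h : V.IsLocalFrame W.carrier s U) {x : X}
    (hx : x ∈ U) : Fintype.card ι = W.rank := by
  rw [← W.finrank_carrier x, ← h.span_eq x hx, finrank_span_eq_card (h.linearIndependent x hx)]

/-- The Gram determinant of a family of sections. -/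
def HermitianMetric.gram (h : V.HermitianMetric) {ι : Type*} [Fintype ι] [DecidableEq ι]
    (s : ι → ∀ x, V.Fiber x) (x : X) : ℝ :=
  gramDetOf (h.form x) fun i => s i x

theorem HermitianMetric.gram_pos (h : V.HermitianMetric) {ι : Type*} [Fintype ι] [DecidableEq ι]
    {s : ι → ∀ x, V.Fiber x} {x : X} (hs : LinearIndependent ℂ fun i => s i x) :
    0 < h.gram s x :=
  gramDetOf_pos (h.conj_symm x) (h.pos x) hs

theorem HermitianMetric.contMDiffAt_gram (h : V.HermitianMetric) {ι : Type*} [Fintype ι]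
    [DecidableEq ι] {s : ι → ∀ x, V.Fiber x} {U : Set X} (hU : IsOpen U)
    (hs : ∀ i, V.IsHolSection (s i) U) {x : X} (hx : x ∈ U) :
    ContMDiffAt 𝓘(ℝ, ℂ) 𝓘(ℝ) ∞ (h.gram s) x := by
  have h1 : ContMDiffAt 𝓘(ℝ, ℂ) 𝓘(ℝ, ℂ) ∞
      (fun y => (Matrix.of fun i j => h.form y (s i y) (s j y)).det) x :=
    ContMDiffAt.matrix_det fun i j =>
      ((h.smooth U (s i) (s j) hU (hs i) (hs j)) x hx).contMDiffAt (hU.mem_nhds hx)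
  exact Complex.reCLM.contDiff.contMDiff.contMDiffAt.comp x h1

end HolVectorBundle

end Sections

/-! ### Independence of the Chern form from the frame -/

section ChernForm

open Laplacian InnerProductSpace HolVectorBundle

variable {X : Type*} [TopologicalSpace X] [ChartedSpace ℂ X] [IsManifold 𝓘(ℂ) ω X] {n : ℕ}
  {V : HolVectorBundle X n}

namespace HolVectorBundle

theorem HermitianMetric.contDiffAt_log_gram (h : V.HermitianMetric) {ι : Type*} [Fintype ι]
    [DecidableEq ι] {s : ι → ∀ x, V.Fiber x} {W : ∀ x, Submodule ℂ (V.Fiber x)} {U : Set X}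
    (hs : V.IsLocalFrame W s U) {p : X} {z : ℂ} (hz : z ∈ (chartAt ℂ p).target)
    (hx : (chartAt ℂ p).symm z ∈ U) :
    ContDiffAt ℝ 2 (fun w => Real.log (h.gram s ((chartAt ℂ p).symm w))) z :=
  (((h.contMDiffAt_gram hs.isOpen hs.isHolSection hx).contDiffAt_comp_chart_symm hz).of_le
    ENat.LEInfty.out).log (h.gram_pos (hs.linearIndependent _ hx)).ne'

/-- The two Gram determinants differ by the squared modulus of the determinant of the change of
frame. That determinant is the quotient of the same maximal minor of the two frames in a
trivialization, so it is holomorphic without regard to the entries of the change of frame, and the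
logarithms differ by a harmonic function. -/
theorem laplacian_log_gram_congr (h : V.HermitianMetric) {ι : Type*} [Fintype ι] [DecidableEq ι]
    {W : ∀ x, Submodule ℂ (V.Fiber x)} {s t : ι → ∀ x, V.Fiber x} {U : Set X}
    (hs : V.IsLocalFrame W s U) (ht : V.IsLocalFrame W t U) {p : X} {z : ℂ}
    (hz : z ∈ (chartAt ℂ p).target) (hx : (chartAt ℂ p).symm z ∈ U) :
    Δ (fun w => Real.log (h.gram s ((chartAt ℂ p).symm w))) z =
      Δ (fun w => Real.log (h.gram t ((chartAt ℂ p).symm w))) z := by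
  set x := (chartAt ℂ p).symm z with hxdef
  have hex : ∀ y ∈ U, ∃ g : Matrix ι ι ℂ, ∀ i, s i y = ∑ j, g i j • t j y := by
    intro y hy
    have : ∀ i, ∃ c : ι → ℂ, ∑ j, c j • t j y = s i y := fun i =>
      (Submodule.mem_span_range_iff_exists_fun ℂ).1 (by rw [ht.span_eq y hy]; exact hs.mem hy i)
    choose g hg using this
    exact ⟨Matrix.of g, fun i => (hg i).symm⟩
  obtain ⟨I, hI⟩ := exists_minor_ne_zero
    ((ht.linearIndependent x hx).map' (V.coord x x) (ker_coord (mem_coordNhd x)))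
  let D : (ι → ∀ x, V.Fiber x) → X → ℂ := fun r y =>
    (Matrix.of fun i j => V.coord x y (r i y) (I j)).det
  have hDan : ∀ r, V.IsLocalFrame W r U →
      AnalyticAt ℂ (fun w => D r ((chartAt ℂ p).symm w)) z := fun r hr =>
    (ContMDiffAt.matrix_det fun i j => (hr.isHolSection i).contMDiffAt_coord_apply hr.isOpen hx
      (mem_coordNhd x) (I j)).analyticAt_comp_chart_symm hz
  have hrel : ∀ y ∈ U, ∃ c : ℂ, c ≠ 0 ∧ D s y = c * D t y ∧
      h.gram s y = Complex.normSq c * h.gram t y := by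
    intro y hy
    obtain ⟨g, hg⟩ := hex y hy
    have hG : h.gram s y = Complex.normSq g.det * h.gram t y :=
      gramDetOf_eq_normSq_mul (h.form y) g hg
    refine ⟨g.det, fun h0 => ?_, ?_, hG⟩
    · have := h.gram_pos (hs.linearIndependent y hy)
      rw [hG, h0] at this
      simp at this
    · have e : (Matrix.of fun i j => V.coord x y (s i y) (I j)) =
          g * Matrix.of fun i j => V.coord x y (t i y) (I j) := by
        ext i j
        simp [hg, Matrix.mul_apply]
      simp only [D, e, Matrix.det_mul]
  have hDt : D t x ≠ 0 := hI
  have hDs : D s x ≠ 0 := by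
    obtain ⟨c, hc, h1, -⟩ := hrel x hx
    rw [h1]
    exact mul_ne_zero hc hDt
  have hcs := (chartAt ℂ p).symm.continuousAt hz
  have hlog : (fun w => Real.log (h.gram s ((chartAt ℂ p).symm w))) =ᶠ[𝓝 z]
      (fun w => Real.log (h.gram t ((chartAt ℂ p).symm w))) +
        ((fun w => Real.log (Complex.normSq (D s ((chartAt ℂ p).symm w)))) -
          fun w => Real.log (Complex.normSq (D t ((chartAt ℂ p).symm w)))) := by
    filter_upwards [hcs.eventually (hs.isOpen.mem_nhds hx),
      (hDan t ht).continuousAt.eventually_ne hDt] with w hw hw'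
    obtain ⟨c, hc, h1, h2⟩ := hrel _ hw
    have hp := h.gram_pos (ht.linearIndependent _ hw)
    have hc' : Complex.normSq c ≠ 0 := by simpa using hc
    have hd' : Complex.normSq (D t ((chartAt ℂ p).symm w)) ≠ 0 := by simpa using hw'
    simp only [Pi.add_apply, Pi.sub_apply, h1, h2, map_mul]
    rw [Real.log_mul hc' hp.ne', Real.log_mul hc' hd']
    ring
  have k1 := harmonicAt_log_normSq (hDan s hs) hDs
  have k2 := harmonicAt_log_normSq (hDan t ht) hDt
  rw [(laplacian_congr_nhds hlog).self_of_nhds,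
    (h.contDiffAt_log_gram ht hz hx).laplacian_add (k1.sub k2).1, (k1.sub k2).2.self_of_nhds]
  simp

/-- The Chern form may be computed in any local frame. -/
theorem Subbundle.chernForm_eq (h : V.HermitianMetric) (W : V.Subbundle) {ι : Type*} [Fintype ι]
    [DecidableEq ι] {s : ι → ∀ x, V.Fiber x} {U : Set X} (hs : V.IsLocalFrame W.carrier s U)
    {p : X} {z : ℂ} (hz : z ∈ (chartAt ℂ p).target) (hx : (chartAt ℂ p).symm z ∈ U) :
    W.chernForm h p z = -(1 / (4 * Real.pi)) *
      Δ (fun w => Real.log (h.gram s ((chartAt ℂ p).symm w))) z := by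
  obtain ⟨U', hx', ht⟩ := W.isLocalFrame_frameAt ((chartAt ℂ p).symm z)
  have hc : Fintype.card (Fin W.rank) = Fintype.card ι := by rw [hs.card_eq hx, Fintype.card_fin]
  let e := Fintype.equivOfCardEq hc
  have hg : ∀ w, h.gram (s ∘ e) w = h.gram s w := fun w =>
    gramDetOf_comp_equiv (h.form w) (fun i => s i w) e
  have hU := hs.isOpen.inter ht.isOpen
  have := laplacian_log_gram_congr h ((hs.comp_equiv e).mono hU Set.inter_subset_left)
    (ht.mono hU Set.inter_subset_right) hz ⟨hx, hx'⟩
  simp only [hg] at this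
  rw [this]
  rfl

/-- The definition uses a frame that changes with the point; continuity appears after passing to one
frame near a given point. -/
theorem Subbundle.continuousOn_chernForm (h : V.HermitianMetric) (W : V.Subbundle) (p : X) :
    ContinuousOn (W.chernForm h p) (chartAt ℂ p).target := by
  intro z hz
  obtain ⟨U, hx, ht⟩ := W.isLocalFrame_frameAt ((chartAt ℂ p).symm z)
  have h1 := (h.contDiffAt_log_gram ht hz hx).continuousAt_laplacian.const_mul
    (-(1 / (4 * Real.pi)))
  refine (h1.congr ?_).continuousWithinAt
  filter_upwards [(chartAt ℂ p).open_target.mem_nhds hz,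
    ((chartAt ℂ p).symm.continuousAt hz).eventually (ht.isOpen.mem_nhds hx)] with w hw hw'
  exact (W.chernForm_eq h ht hw hw').symm

end HolVectorBundle

end ChernForm

/-! ### The norm of the determinant of a pairing -/

section PairingNorm

variable {W Z : Type*} [AddCommGroup W] [Module ℂ W] [AddCommGroup Z] [Module ℂ Z]
  {κ κ' ι : Type*} [Fintype κ] [DecidableEq κ] [Fintype κ'] [DecidableEq κ'] [Fintype ι]
  [DecidableEq ι]

/-- `(k, e)` is a basis of `A` that extends the basis `k` of `K`. -/
structure IsAdapted (K A : Submodule ℂ W) (k : κ → W) (e : ι → W) : Prop where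
  linearIndependent : LinearIndependent ℂ (Sum.elim k e)
  span_left : Submodule.span ℂ (Set.range k) = K
  span_eq : Submodule.span ℂ (Set.range (Sum.elim k e)) = A

namespace IsAdapted

variable {K A : Submodule ℂ W} {k k₂ : κ → W} {e e₂ : ι → W}

omit [DecidableEq κ] [DecidableEq ι] in
theorem exists_coeff (h : IsAdapted K A k e) {v : W} (hv : v ∈ A) :
    ∃ (c : κ → ℂ) (d : ι → ℂ), v = ∑ i, c i • k i + ∑ j, d j • e j := by
  rw [← h.span_eq, Submodule.mem_span_range_iff_exists_fun] at hv
  obtain ⟨c, rfl⟩ := hv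
  exact ⟨fun i => c (.inl i), fun j => c (.inr j), by simp⟩

omit [Fintype κ] [DecidableEq κ] [Fintype ι] [DecidableEq ι] in
theorem mem_left (h : IsAdapted K A k e) (i : κ) : k i ∈ K :=
  h.span_left ▸ Submodule.subset_span ⟨i, rfl⟩

omit [Fintype κ] [DecidableEq κ] [Fintype ι] [DecidableEq ι] in
theorem mem_right (h : IsAdapted K A k e) (j : ι) : e j ∈ A :=
  h.span_eq ▸ Submodule.subset_span ⟨.inr j, rfl⟩

omit [Fintype κ] [DecidableEq κ] [Fintype ι] [DecidableEq ι] in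
theorem linearIndependent_left (h : IsAdapted K A k e) : LinearIndependent ℂ k := by
  simpa using! h.linearIndependent.comp Sum.inl Sum.inl_injective

/-- The ratio of the squared norm of a determinant of functionals that vanish on `K` to the volume
of `A / K` does not depend on the adapted basis. -/
theorem normSq_det_mul_ratio {B : W →ₗ⋆[ℂ] W →ₗ[ℂ] ℂ} (hB : ∀ v w, conj (B v w) = B w v)
    (hpos : ∀ v, v ≠ 0 → 0 < (B v v).re) (h : IsAdapted K A k e) (h₂ : IsAdapted K A k₂ e₂)
    (φ : ι → W →ₗ[ℂ] ℂ) (hφ : ∀ j, ∀ v ∈ K, φ j v = 0) :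
    Complex.normSq (Matrix.of fun i j => φ j (e₂ i)).det *
        (gramDetOf B k₂ / gramDetOf B (Sum.elim k₂ e₂)) =
      Complex.normSq (Matrix.of fun i j => φ j (e i)).det *
        (gramDetOf B k / gramDetOf B (Sum.elim k e)) := by
  have hP : ∀ i, ∃ c : κ → ℂ, ∑ j, c j • k j = k₂ i := fun i =>
    (Submodule.mem_span_range_iff_exists_fun ℂ).1 (by rw [h.span_left]; exact h₂.mem_left i)
  choose P hP using hP
  choose R S hRS using fun i => h.exists_coeff (h₂.mem_right i)
  have g1 : gramDetOf B k₂ = Complex.normSq (Matrix.of P).det * gramDetOf B k :=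
    gramDetOf_eq_normSq_mul B (Matrix.of P) fun i => (hP i).symm
  have g2 : gramDetOf B (Sum.elim k₂ e₂) =
      Complex.normSq ((Matrix.of P).det * (Matrix.of S).det) * gramDetOf B (Sum.elim k e) := by
    rw [← Matrix.det_fromBlocks_zero₁₂ (Matrix.of P) (Matrix.of R)]
    refine gramDetOf_eq_normSq_mul B _ fun i => ?_
    cases i with
    | inl i => simp [← hP]
    | inr i => simp [hRS]
  have d1 : (Matrix.of fun i j => φ j (e₂ i)).det =
      (Matrix.of S).det * (Matrix.of fun i j => φ j (e i)).det := by
    rw [← Matrix.det_mul]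
    congr 1
    ext i j
    simp [Matrix.mul_apply, hRS, hφ _ _ (h.mem_left _)]
  have p1 := gramDetOf_pos hB hpos h₂.linearIndependent
  have p2 := gramDetOf_pos hB hpos h.linearIndependent
  rw [g2, map_mul] at p1
  have hP0 : Complex.normSq (Matrix.of P).det ≠ 0 := by
    intro h0
    rw [h0] at p1
    simp at p1
  have hS0 : Complex.normSq (Matrix.of S).det ≠ 0 := by
    intro h0
    rw [h0] at p1
    simp at p1
  rw [d1, g1, g2, map_mul, map_mul]
  field_simp

end IsAdapted

/-- The squared norm of the determinant of the pairing `A / K × A' / K' → Z` induced by `γ`,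
computed from adapted bases `(k, e)` and `(k', f)` and a basis `σ` of the line `Z`. -/
def pairingNorm (B : W →ₗ⋆[ℂ] W →ₗ[ℂ] ℂ) (C : Z →ₗ⋆[ℂ] Z →ₗ[ℂ] ℂ) (γ : W →ₗ[ℂ] W →ₗ[ℂ] Z)
    (σ : Z) (k : κ → W) (e : ι → W) (k' : κ' → W) (f : ι → W) : ℝ :=
  Complex.normSq (Matrix.of fun i j => C σ (γ (e i) (f j))).det *
    (gramDetOf B k / gramDetOf B (Sum.elim k e)) *
    (gramDetOf B k' / gramDetOf B (Sum.elim k' f)) / (C σ σ).re ^ Fintype.card ι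

variable {B : W →ₗ⋆[ℂ] W →ₗ[ℂ] ℂ} {C : Z →ₗ⋆[ℂ] Z →ₗ[ℂ] ℂ} {γ : W →ₗ[ℂ] W →ₗ[ℂ] Z}
  {K A K' A' : Submodule ℂ W} {k k₂ : κ → W} {e e₂ : ι → W} {k' k₂' : κ' → W} {f f₂ : ι → W}
  {σ τ : Z}

/-- The bases are changed one side at a time by `normSq_det_mul_ratio`, since either argument of `γ`
supplies functionals killing the kernel of the other. Replacing `σ` by `c • σ` multiplies both the
squared determinant and the denominator by `|c| ^ (2 r)`, with `r` the size of the determinant. -/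
theorem pairingNorm_eq (hB : ∀ v w, conj (B v w) = B w v)
    (hBpos : ∀ v, v ≠ 0 → 0 < (B v v).re) (hCpos : ∀ v, v ≠ 0 → 0 < (C v v).re)
    (hK : ∀ v ∈ K, ∀ w ∈ A', γ v w = 0) (hK' : ∀ v ∈ A, ∀ w ∈ K', γ v w = 0)
    (h : IsAdapted K A k e) (h₂ : IsAdapted K A k₂ e₂) (h' : IsAdapted K' A' k' f)
    (h₂' : IsAdapted K' A' k₂' f₂) (hσ : σ ≠ 0) (hτ : τ ≠ 0) {c : ℂ} (hc : τ = c • σ) :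
    pairingNorm B C γ τ k₂ e₂ k₂' f₂ = pairingNorm B C γ σ k e k' f := by
  have s1 : pairingNorm B C γ τ k₂ e₂ k₂' f₂ = pairingNorm B C γ τ k e k₂' f₂ := by
    have := h.normSq_det_mul_ratio hB hBpos h₂ (fun j => (C τ).comp (γ.flip (f₂ j)))
      (fun j v hv => by simp [hK v hv _ (h₂'.mem_right j)])
    simp only [LinearMap.comp_apply, LinearMap.flip_apply] at this
    rw [pairingNorm, pairingNorm, this]
  have s2 : pairingNorm B C γ τ k e k₂' f₂ = pairingNorm B C γ τ k e k' f := by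
    have := h'.normSq_det_mul_ratio hB hBpos h₂' (fun j => (C τ).comp (γ (e j)))
      (fun j v hv => by simp [hK' _ (h.mem_right j) v hv])
    simp only [LinearMap.comp_apply] at this
    have ht : ∀ f : ι → W, (Matrix.of fun i j => C τ (γ (e i) (f j))).det =
        (Matrix.of fun i j => C τ (γ (e j) (f i))).det := fun f => by
      rw [← Matrix.det_transpose]
      rfl
    rw [pairingNorm, pairingNorm, ht, ht, mul_right_comm, this, mul_right_comm]
  rw [s1, s2, pairingNorm, pairingNorm]
  have hc0 : c ≠ 0 := fun h0 => hτ (by simp [hc, h0])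
  have e1 : (Matrix.of fun i j => C τ (γ (e i) (f j))).det =
      conj c ^ Fintype.card ι * (Matrix.of fun i j => C σ (γ (e i) (f j))).det := by
    rw [← Matrix.det_smul]
    congr 1
    ext i j
    simp [hc]
  have e2 : (C τ τ).re = Complex.normSq c * (C σ σ).re := by
    have : C τ τ = (c * conj c) * C σ σ := by simp [hc]; ring
    rw [this, Complex.mul_conj, Complex.re_ofReal_mul]
  have h1 : Complex.normSq c ≠ 0 := by simpa using hc0
  have h2 := (hCpos σ hσ).ne'
  rw [e1, e2, map_mul, map_pow, Complex.normSq_conj, mul_pow]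
  field_simp

theorem pairingNorm_nonneg (hB : ∀ v w, conj (B v w) = B w v)
    (hBpos : ∀ v, v ≠ 0 → 0 < (B v v).re) (hCpos : ∀ v, v ≠ 0 → 0 < (C v v).re)
    (h : IsAdapted K A k e) (h' : IsAdapted K' A' k' f) (hσ : σ ≠ 0) :
    0 ≤ pairingNorm B C γ σ k e k' f := by
  have p1 := gramDetOf_pos hB hBpos h.linearIndependent
  have p2 := gramDetOf_pos hB hBpos h'.linearIndependent
  have p3 := gramDetOf_pos hB hBpos h.linearIndependent_left
  have p4 := gramDetOf_pos hB hBpos h'.linearIndependent_left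
  have p5 := hCpos σ hσ
  have p6 := Complex.normSq_nonneg (Matrix.of fun i j => C σ (γ (e i) (f j))).det
  unfold pairingNorm
  positivity

/-- The components of `v` and `w` along `K` and `K'` pair to zero. Hence any minor of the pairing
is, up to a scalar, the determinant in the adapted bases between two coefficient matrices. -/
theorem pairingNorm_ne_zero (hB : ∀ v w, conj (B v w) = B w v)
    (hBpos : ∀ v, v ≠ 0 → 0 < (B v v).re) (hCpos : ∀ v, v ≠ 0 → 0 < (C v v).re)
    (hK : ∀ v ∈ K, ∀ w ∈ A', γ v w = 0) (hK' : ∀ v ∈ A, ∀ w ∈ K', γ v w = 0)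
    (h : IsAdapted K A k e) (h' : IsAdapted K' A' k' f) (hσ : σ ≠ 0)
    (hspan : ∀ z : Z, ∃ c : ℂ, z = c • σ) {v w : ι → W} (hv : ∀ i, v i ∈ A) (hw : ∀ i, w i ∈ A')
    {l : Z →ₗ[ℂ] ℂ} (hdet : (Matrix.of fun i j => l (γ (v i) (w j))).det ≠ 0) :
    pairingNorm B C γ σ k e k' f ≠ 0 := by
  have p1 := gramDetOf_pos hB hBpos h.linearIndependent
  have p2 := gramDetOf_pos hB hBpos h'.linearIndependent
  have p3 := gramDetOf_pos hB hBpos h.linearIndependent_left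
  have p4 := gramDetOf_pos hB hBpos h'.linearIndependent_left
  have p5 := hCpos σ hσ
  have hN : (Matrix.of fun i j => C σ (γ (e i) (f j))).det ≠ 0 := by
    intro h0
    apply hdet
    choose R S hRS using fun i => h.exists_coeff (hv i)
    choose R' T hT using fun i => h'.exists_coeff (hw i)
    have hne : C σ σ ≠ 0 := fun h1 => by simp [h1] at p5
    have hl : ∀ z, l z = (l σ / C σ σ) * C σ z := by
      intro z
      obtain ⟨c, rfl⟩ := hspan z
      simp only [map_smul, smul_eq_mul]
      field_simp
    have hγ : ∀ i j, γ (v i) (w j) = ∑ a, ∑ b, (S i a * T j b) • γ (e a) (f b) := by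
      intro i j
      have z1 : γ (∑ a, R i a • k a) (w j) = 0 := by
        simp [hK _ (h.mem_left _) _ (hw j)]
      have z2 : ∀ a, γ (e a) (∑ b, R' j b • k' b) = 0 := fun a => by
        simp [hK' _ (h.mem_right a) _ (h'.mem_left _)]
      rw [hRS i, map_add, LinearMap.add_apply, z1, zero_add, map_sum, LinearMap.sum_apply]
      refine Finset.sum_congr rfl fun a _ => ?_
      rw [map_smul, LinearMap.smul_apply, hT j, map_add, z2, zero_add, map_sum, Finset.smul_sum]
      exact Finset.sum_congr rfl fun b _ => by rw [map_smul, smul_smul]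
    have e1 : (Matrix.of fun i j => l (γ (v i) (w j))) = (l σ / C σ σ) •
        (Matrix.of S * (Matrix.of fun i j => C σ (γ (e i) (f j))) * (Matrix.of T).transpose) := by
      ext i j
      rw [Matrix.of_apply, hl, hγ]
      simp only [map_sum, map_smul, smul_eq_mul, Matrix.smul_apply, Matrix.mul_apply,
        Matrix.of_apply, Matrix.transpose_apply, Finset.sum_mul]
      rw [Finset.sum_comm]
      congr 1
      exact Finset.sum_congr rfl fun b _ => Finset.sum_congr rfl fun a _ => by ring
    rw [e1, Matrix.det_smul, Matrix.det_mul, Matrix.det_mul, h0]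
    simp
  have p6 : 0 < Complex.normSq (Matrix.of fun i j => C σ (γ (e i) (f j))).det :=
    Complex.normSq_pos.2 hN
  unfold pairingNorm
  positivity

end PairingNorm

/-! ### The degree inequality for a pairing of subbundles -/

section

open Laplacian InnerProductSpace

/-- Shaped after the expansion of the logarithm of a pairing norm: a harmonic part from holomorphic
determinants, the metric of `L`, and the Gram determinants of the two quotients. -/
theorem laplacian_harmonic_add {g f₁ f₂ f₃ f₄ f₅ : ℂ → ℝ} {z : ℂ} {c : ℝ} (hg : HarmonicAt g z)
    (h₁ : ContDiffAt ℝ 2 f₁ z) (h₂ : ContDiffAt ℝ 2 f₂ z) (h₃ : ContDiffAt ℝ 2 f₃ z)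
    (h₄ : ContDiffAt ℝ 2 f₄ z) (h₅ : ContDiffAt ℝ 2 f₅ z) :
    Δ (g + (c • f₁ + ((f₂ - f₃) + (f₄ - f₅)))) z =
      c * Δ f₁ z + ((Δ f₂ z - Δ f₃ z) + (Δ f₄ z - Δ f₅ z)) := by
  have k₁ : ContDiffAt ℝ 2 (c • f₁) z := h₁.const_smul c
  have k₂ : ContDiffAt ℝ 2 (f₂ - f₃) z := h₂.sub h₃
  have k₃ : ContDiffAt ℝ 2 (f₄ - f₅) z := h₄.sub h₅
  have k₄ : ContDiffAt ℝ 2 (f₂ - f₃ + (f₄ - f₅)) z := k₂.add k₃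
  have k₅ : ContDiffAt ℝ 2 (c • f₁ + (f₂ - f₃ + (f₄ - f₅))) z := k₁.add k₄
  rw [hg.1.laplacian_add k₅, hg.2.self_of_nhds, k₁.laplacian_add k₄, k₂.laplacian_add k₃,
    h₂.laplacian_sub h₃, h₄.laplacian_sub h₅, laplacian_smul _ h₁]
  simp

end

namespace HolVectorBundle

variable {X : Type*} [TopologicalSpace X] [ChartedSpace ℂ X] {n : ℕ} {V : HolVectorBundle X n}

/-- A holomorphic frame of `K` completed to a holomorphic frame of `A`. -/
structure IsAdaptedFrame (K A : V.Subbundle) {κ ι : Type*} (k : κ → ∀ x, V.Fiber x)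
    (e : ι → ∀ x, V.Fiber x) (U : Set X) : Prop where
  left : V.IsLocalFrame K.carrier k U
  whole : V.IsLocalFrame A.carrier (Sum.elim k e) U

theorem IsAdaptedFrame.isAdapted {K A : V.Subbundle} {κ ι : Type*} {k : κ → ∀ x, V.Fiber x}
    {e : ι → ∀ x, V.Fiber x} {U : Set X} (h : IsAdaptedFrame K A k e U) {x : X} (hx : x ∈ U) :
    IsAdapted (K.carrier x) (A.carrier x) (fun i => k i x) (fun j => e j x) := by
  have e1 : (Sum.elim (fun i => k i x) fun j => e j x) = fun i => Sum.elim k e i x := by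
    funext i
    cases i <;> rfl
  exact ⟨e1 ▸ h.whole.linearIndependent x hx, h.left.span_eq x hx, e1 ▸ h.whole.span_eq x hx⟩

theorem IsAdaptedFrame.mono {K A : V.Subbundle} {κ ι : Type*} {k : κ → ∀ x, V.Fiber x}
    {e : ι → ∀ x, V.Fiber x} {U U' : Set X} (h : IsAdaptedFrame K A k e U) (hU' : IsOpen U')
    (hU : U' ⊆ U) : IsAdaptedFrame K A k e U' :=
  ⟨h.left.mono hU' hU, h.whole.mono hU' hU⟩

/-- Members of a frame of `A` whose classes form a basis of `A / K` at the point complete a frame of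
`K`; independence persists nearby, and dimension forces the span. -/
theorem exists_adaptedFrame {K A : V.Subbundle} (hKA : ∀ x, K.carrier x ≤ A.carrier x) {r : ℕ}
    (hr : K.rank + r = A.rank) (x : X) :
    ∃ (U : Set X) (k : Fin K.rank → ∀ x, V.Fiber x) (e : Fin r → ∀ x, V.Fiber x),
      x ∈ U ∧ IsAdaptedFrame K A k e U := by
  obtain ⟨U₁, hx₁, hk⟩ := K.isLocalFrame_frameAt x
  obtain ⟨U₂, hx₂, ha⟩ := A.isLocalFrame_frameAt x
  set k := K.frameAt x
  set a := A.frameAt x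
  let q := (K.carrier x).mkQ
  have hspan : Submodule.span ℂ (Set.range fun i => q (a i x)) = (A.carrier x).map q := by
    rw [← ha.span_eq x hx₂, Submodule.map_span, ← Set.range_comp]
    rfl
  have hrank : Module.finrank ℂ ((A.carrier x).map q) = r := by
    have h1 := LinearMap.finrank_range_add_finrank_ker (q.domRestrict (A.carrier x))
    rw [LinearMap.range_domRestrict, LinearMap.ker_domRestrict, Submodule.ker_mkQ,
      A.finrank_carrier, (Submodule.comapSubtypeEquivOfLe (hKA x)).finrank_eq,
      K.finrank_carrier] at h1
    omega
  obtain ⟨f, hf, -⟩ := exists_comp_basis_of_span hspan hrank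
  let e : Fin r → ∀ x, V.Fiber x := fun j => a (f j)
  have hli : LinearIndependent ℂ fun i => Sum.elim k e i x := by
    have hk' : LinearIndependent ℂ fun i => (⟨k i x, hk.mem hx₁ i⟩ : K.carrier x) :=
      LinearIndependent.of_comp (K.carrier x).subtype (hk.linearIndependent x hx₁)
    have := hk'.sumElim_of_quotient (fun j => e j x) hf
    convert! this using 1
    funext i
    cases i <;> rfl
  have hhol : ∀ i, V.IsHolSection (Sum.elim k e i) (U₁ ∩ U₂) := by
    rintro (i | i)
    · exact (hk.isHolSection i).mono Set.inter_subset_left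
    · exact (ha.isHolSection (f i)).mono Set.inter_subset_right
  have hopen := hk.isOpen.inter ha.isOpen
  obtain ⟨O, hO, hOo, hxO⟩ := eventually_nhds_iff.1
    (eventually_linearIndependent hopen hhol ⟨hx₁, hx₂⟩ hli)
  refine ⟨O ∩ (U₁ ∩ U₂), k, e, ⟨hxO, hx₁, hx₂⟩,
    hk.mono (hOo.inter hopen) fun y hy => hy.2.1, hOo.inter hopen,
    fun i => (hhol i).mono Set.inter_subset_right, fun y hy => hO y hy.1, fun y hy => ?_⟩
  refine Submodule.eq_of_le_of_finrank_eq (Submodule.span_le.2 ?_) ?_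
  · rintro _ ⟨i | i, rfl⟩
    · exact hKA y (hk.mem hy.2.1 i)
    · exact ha.mem hy.2.2 (f i)
  · rw [finrank_span_eq_card (hO y hy.1), A.finrank_carrier]
    simpa using hr

end HolVectorBundle

/-! ### The determinant of a pairing as a function on the surface -/

namespace QuadricBundle

open HolVectorBundle Laplacian InnerProductSpace

variable {X : Type*} [TopologicalSpace X] [ChartedSpace ℂ X] {n : ℕ} {L : HolVectorBundle X 1}

/-- The pairing of `A` and `B` by `γ` has rank at least `r` at the point `y`: some minor of size `r`
does not vanish. -/
def HasRank (Q : QuadricBundle L n) (A B : Q.V.Subbundle) (r : ℕ) (y : X) : Prop :=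
  ∃ (v w : Fin r → Q.V.Fiber y) (l : L.Fiber y →ₗ[ℂ] ℂ), (∀ i, v i ∈ A.carrier y) ∧
    (∀ i, w i ∈ B.carrier y) ∧ (Matrix.of fun i j => l (Q.γ y (v i) (w j))).det ≠ 0

theorem exists_line_frame (L : HolVectorBundle X 1) (x : X) :
    ∃ (U : Set X) (σ : ∀ x, L.Fiber x), x ∈ U ∧
      L.IsLocalFrame L.whole.carrier (fun _ : Fin 1 => σ) U := by
  obtain ⟨U, hx, h⟩ := L.whole.isLocalFrame_frameAt x
  have : (fun _ : Fin 1 => (L.whole.frameAt x (0 : Fin 1))) = L.whole.frameAt x := by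
    funext i
    rw [Subsingleton.elim (0 : Fin 1) i]
  exact ⟨U, L.whole.frameAt x (0 : Fin 1), hx, by rw [this]; exact h⟩

theorem line_frame_spec {σ : ∀ x, L.Fiber x} {U : Set X}
    (h : L.IsLocalFrame L.whole.carrier (fun _ : Fin 1 => σ) U) {x : X} (hx : x ∈ U) :
    σ x ≠ 0 ∧ ∀ z : L.Fiber x, ∃ c : ℂ, z = c • σ x := by
  refine ⟨(h.linearIndependent x hx).ne_zero 0, fun z => ?_⟩
  have hz : z ∈ L.whole.carrier x := Submodule.mem_top
  rw [← h.span_eq x hx, Set.range_const, Submodule.mem_span_singleton] at hz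
  obtain ⟨c, rfl⟩ := hz
  exact ⟨c, rfl⟩

variable {Q : QuadricBundle L n} {A B K K' : Q.V.Subbundle} {r : ℕ}

/-- The local data in which the norm of the determinant of the pairing
`A / K × B / K' → L` is computed. -/
structure IsPairingFrame (K A K' B : Q.V.Subbundle) (σ : ∀ x, L.Fiber x)
    (k : Fin K.rank → ∀ x, Q.V.Fiber x) (e : Fin r → ∀ x, Q.V.Fiber x)
    (k' : Fin K'.rank → ∀ x, Q.V.Fiber x) (f : Fin r → ∀ x, Q.V.Fiber x) (U : Set X) : Prop where
  line : L.IsLocalFrame L.whole.carrier (fun _ : Fin 1 => σ) U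
  left : IsAdaptedFrame K A k e U
  right : IsAdaptedFrame K' B k' f U

theorem exists_pairingFrame (hKA : ∀ x, K.carrier x ≤ A.carrier x)
    (hKB : ∀ x, K'.carrier x ≤ B.carrier x) (hA : K.rank + r = A.rank) (hB : K'.rank + r = B.rank)
    (x : X) : ∃ U σ k, ∃ e : Fin r → ∀ x, Q.V.Fiber x, ∃ k', ∃ f : Fin r → ∀ x, Q.V.Fiber x,
      x ∈ U ∧ IsPairingFrame K A K' B σ k e k' f U := by
  obtain ⟨U₁, σ, hx₁, h₁⟩ := exists_line_frame L x
  obtain ⟨U₂, k, e, hx₂, h₂⟩ := exists_adaptedFrame hKA hA x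
  obtain ⟨U₃, k', f, hx₃, h₃⟩ := exists_adaptedFrame hKB hB x
  have ho := h₁.isOpen.inter (h₂.left.isOpen.inter h₃.left.isOpen)
  exact ⟨U₁ ∩ (U₂ ∩ U₃), σ, k, e, k', f, ⟨hx₁, hx₂, hx₃⟩, h₁.mono ho fun _ h => h.1,
    h₂.mono ho fun _ h => h.2.1, h₃.mono ho fun _ h => h.2.2⟩

/-- The global function given in local frames by `pairingNorm`. -/
theorem exists_pairing_function (h : Q.V.HermitianMetric) (hL : L.HermitianMetric)
    (hKA : ∀ x, K.carrier x ≤ A.carrier x) (hKB : ∀ x, K'.carrier x ≤ B.carrier x)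
    (hA : K.rank + r = A.rank) (hB : K'.rank + r = B.rank) (hK : Q.Annihilates K B)
    (hK' : Q.Annihilates A K') :
    ∃ u : X → ℝ, ∀ U σ k (e : Fin r → ∀ x, Q.V.Fiber x) k' (f : Fin r → ∀ x, Q.V.Fiber x),
      IsPairingFrame K A K' B σ k e k' f U → ∀ y ∈ U,
        u y = pairingNorm (h.form y) (hL.form y) (Q.γ y) (σ y) (fun i => k i y) (fun i => e i y)
          (fun i => k' i y) (fun i => f i y) := by
  choose U σ k e k' f hx hf using exists_pairingFrame hKA hKB hA hB
  -- The value at `y` is computed in the frame chosen for `y` itself; `pairingNorm_eq` makes it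
  -- agree with every other frame.
  refine ⟨fun y => pairingNorm (h.form y) (hL.form y) (Q.γ y) (σ y y) (fun i => k y i y)
    (fun i => e y i y) (fun i => k' y i y) (fun i => f y i y), ?_⟩
  intro U₂ σ₂ k₂ e₂ k₂' f₂ hf₂ y hy
  obtain ⟨hσ, -⟩ := line_frame_spec (hf y).line (hx y)
  obtain ⟨hσ₂, hs₂⟩ := line_frame_spec hf₂.line hy
  obtain ⟨c, hc⟩ := hs₂ (σ y y)
  exact pairingNorm_eq (h.conj_symm y) (h.pos y) (hL.pos y) (hK y) (hK' y)
    (hf₂.left.isAdapted hy) ((hf y).left.isAdapted (hx y)) (hf₂.right.isAdapted hy)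
    ((hf y).right.isAdapted (hx y)) hσ₂ hσ hc

theorem sumElim_eval {κ ι : Type*} {V : HolVectorBundle X n} (k : κ → ∀ x, V.Fiber x)
    (e : ι → ∀ x, V.Fiber x) (y : X) :
    (Sum.elim (fun i => k i y) fun i => e i y) = fun i => Sum.elim k e i y := by
  funext i
  cases i <;> rfl

theorem contMDiffAt_normSq_det (hL : L.HermitianMetric) {σ : ∀ x, L.Fiber x}
    {k : Fin K.rank → ∀ x, Q.V.Fiber x} {e : Fin r → ∀ x, Q.V.Fiber x}
    {k' : Fin K'.rank → ∀ x, Q.V.Fiber x} {f : Fin r → ∀ x, Q.V.Fiber x} {U : Set X}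
    (hf : IsPairingFrame K A K' B σ k e k' f U) {x : X} (hx : x ∈ U) :
    ContMDiffAt 𝓘(ℝ, ℂ) 𝓘(ℝ) ∞ (fun y => Complex.normSq
      (Matrix.of fun i j => hL.form y (σ y) (Q.γ y (e i y) (f j y))).det) x := by
  have ho := hf.line.isOpen
  have h1 : ContMDiffAt 𝓘(ℝ, ℂ) 𝓘(ℝ, ℂ) ∞ (fun y =>
      (Matrix.of fun i j => hL.form y (σ y) (Q.γ y (e i y) (f j y))).det) x :=
    ContMDiffAt.matrix_det fun i j => ((hL.smooth U σ _ ho (hf.line.isHolSection 0)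
      (Q.holomorphic U (e i) (f j) ho (hf.left.whole.isHolSection (.inr i))
        (hf.right.whole.isHolSection (.inr j)))) x hx).contMDiffAt (ho.mem_nhds hx)
  have h2 : ContDiff ℝ ∞ Complex.normSq := by
    have : (Complex.normSq : ℂ → ℝ) = fun z => z.re * z.re + z.im * z.im := by
      funext z; exact Complex.normSq_apply z
    rw [this]
    exact (Complex.reCLM.contDiff.mul Complex.reCLM.contDiff).add
      (Complex.imCLM.contDiff.mul Complex.imCLM.contDiff)
  exact h2.contMDiff.contMDiffAt.comp x h1

theorem gram_line_frame (hL : L.HermitianMetric) (σ : ∀ x, L.Fiber x) (y : X) :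
    hL.gram (fun _ : Fin 1 => σ) y = (hL.form y (σ y) (σ y)).re := by
  simp [HermitianMetric.gram, gramDetOf]

theorem contMDiffAt_pairing_function (h : Q.V.HermitianMetric) (hL : L.HermitianMetric) {u : X → ℝ}
    {σ : ∀ x, L.Fiber x}
    {k : Fin K.rank → ∀ x, Q.V.Fiber x} {e : Fin r → ∀ x, Q.V.Fiber x}
    {k' : Fin K'.rank → ∀ x, Q.V.Fiber x} {f : Fin r → ∀ x, Q.V.Fiber x} {U : Set X}
    (hf : IsPairingFrame K A K' B σ k e k' f U)
    (hu : ∀ y ∈ U, u y = pairingNorm (h.form y) (hL.form y) (Q.γ y) (σ y) (fun i => k i y)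
      (fun i => e i y) (fun i => k' i y) (fun i => f i y)) {x : X} (hx : x ∈ U) :
    ContMDiffAt 𝓘(ℝ, ℂ) 𝓘(ℝ) ∞ u x := by
  have g : ∀ {m : ℕ} {V : HolVectorBundle X m} (h : V.HermitianMetric) {ι : Type} [Fintype ι]
      [DecidableEq ι] {s : ι → ∀ x, V.Fiber x} {W : ∀ x, Submodule ℂ (V.Fiber x)},
      V.IsLocalFrame W s U → ContMDiffAt 𝓘(ℝ, ℂ) 𝓘(ℝ) ∞ (h.gram s) x ∧ h.gram s x ≠ 0 :=
    fun h _ _ _ _ _ hs => ⟨h.contMDiffAt_gram hs.isOpen hs.isHolSection hx,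
      (h.gram_pos (hs.linearIndependent x hx)).ne'⟩
  have key : ContMDiffAt 𝓘(ℝ, ℂ) 𝓘(ℝ) ∞ (fun y => Complex.normSq
      (Matrix.of fun i j => hL.form y (σ y) (Q.γ y (e i y) (f j y))).det *
      (h.gram k y / h.gram (Sum.elim k e) y) * (h.gram k' y / h.gram (Sum.elim k' f) y) /
        hL.gram (fun _ : Fin 1 => σ) y ^ r) x := by
    refine (((contMDiffAt_normSq_det hL hf hx).mul ?_).mul ?_).div₀ ?_ ?_
    · exact (g h hf.left.left).1.div₀ (g h hf.left.whole).1 (g h hf.left.whole).2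
    · exact (g h hf.right.left).1.div₀ (g h hf.right.whole).1 (g h hf.right.whole).2
    · exact (g hL hf.line).1.pow r
    · exact pow_ne_zero _ (g hL hf.line).2
  refine key.congr_of_eventuallyEq ?_
  filter_upwards [hf.line.isOpen.mem_nhds hx] with y hy
  rw [hu y hy, pairingNorm, gram_line_frame, Fintype.card_fin, sumElim_eval, sumElim_eval]
  rfl

variable [IsManifold 𝓘(ℂ) ω X]

/-- Near the point, `log u` is `log |D|² - r log |S|²`, which is harmonic, plus logarithms of Gram
determinants, whose Laplacians are Chern forms. -/
theorem laplacian_log_pairing_function (h : Q.V.HermitianMetric) (hL : L.HermitianMetric)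
    {u : X → ℝ} {σ : ∀ x, L.Fiber x}
    {k : Fin K.rank → ∀ x, Q.V.Fiber x} {e : Fin r → ∀ x, Q.V.Fiber x}
    {k' : Fin K'.rank → ∀ x, Q.V.Fiber x} {f : Fin r → ∀ x, Q.V.Fiber x} {U : Set X}
    (hf : IsPairingFrame K A K' B σ k e k' f U)
    (hu : ∀ y ∈ U, u y = pairingNorm (h.form y) (hL.form y) (Q.γ y) (σ y) (fun i => k i y)
      (fun i => e i y) (fun i => k' i y) (fun i => f i y)) {p : X} {z : ℂ}
    (hz : z ∈ (chartAt ℂ p).target) (hx : (chartAt ℂ p).symm z ∈ U)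
    (hne : u ((chartAt ℂ p).symm z) ≠ 0) :
    Δ (fun w => Real.log (u ((chartAt ℂ p).symm w))) z = -(4 * Real.pi) *
      (r * L.whole.chernForm hL p z + (K.chernForm h p z - A.chernForm h p z) +
        (K'.chernForm h p z - B.chernForm h p z)) := by
  set x := (chartAt ℂ p).symm z with hxdef
  have hcs := (chartAt ℂ p).symm.continuousAt hz
  -- the holomorphic determinant and the coordinate of `σ`
  let D : X → ℂ := fun y => (Matrix.of fun i j => L.coord x y (Q.γ y (e i y) (f j y)) 0).det
  let S : X → ℂ := fun y => L.coord x y (σ y) 0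
  have ho := hf.line.isOpen
  have hD : AnalyticAt ℂ (fun w => D ((chartAt ℂ p).symm w)) z :=
    (ContMDiffAt.matrix_det fun i j => (Q.holomorphic U (e i) (f j) ho
      (hf.left.whole.isHolSection (.inr i))
      (hf.right.whole.isHolSection (.inr j))).contMDiffAt_coord_apply ho hx
      (mem_coordNhd x) 0).analyticAt_comp_chart_symm hz
  have hS : AnalyticAt ℂ (fun w => S ((chartAt ℂ p).symm w)) z :=
    ((hf.line.isHolSection 0).contMDiffAt_coord_apply ho hx
      (mem_coordNhd x) 0).analyticAt_comp_chart_symm hz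
  have hS0 : S x ≠ 0 := by
    intro h0
    apply (line_frame_spec hf.line hx).1
    apply (coord_bijective (V := L) (mem_coordNhd x)).1
    ext i
    rw [Subsingleton.elim i 0]
    simpa using h0
  -- In a line, pairing with `σ` is a multiple of the coordinate. The determinant defining `u` is
  -- thus the holomorphic `D` times a factor made of the norm of `σ` and its coordinate `S`.
  have hform : ∀ y ∈ U, S y ≠ 0 →
      (Matrix.of fun i j => hL.form y (σ y) (Q.γ y (e i y) (f j y))).det =
        (((hL.gram (fun _ : Fin 1 => σ) y : ℝ) : ℂ) / S y) ^ r * D y := by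
    intro y hy hSy
    have e1 : (Matrix.of fun i j => hL.form y (σ y) (Q.γ y (e i y) (f j y))) =
        (((hL.gram (fun _ : Fin 1 => σ) y : ℝ) : ℂ) / S y) •
          (Matrix.of fun i j => L.coord x y (Q.γ y (e i y) (f j y)) 0) := by
      ext i j
      obtain ⟨c, hc⟩ := (line_frame_spec hf.line hy).2 (Q.γ y (e i y) (f j y))
      have hre : (((hL.form y (σ y) (σ y)).re : ℝ) : ℂ) = hL.form y (σ y) (σ y) :=
        Complex.conj_eq_iff_re.1 (hL.conj_symm y (σ y) (σ y))
      simp only [Matrix.of_apply, Matrix.smul_apply, smul_eq_mul, hc, map_smul, PiLp.smul_apply,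
        gram_line_frame, hre]
      change c * _ = _ / S y * (c * S y)
      field_simp
    rw [e1, Matrix.det_smul, Fintype.card_fin]
  have hDx : D x ≠ 0 := by
    intro h0
    apply hne
    rw [hu x hx, pairingNorm, hform x hx hS0, h0]
    simp
  have hlog : (fun w => Real.log (u ((chartAt ℂ p).symm w))) =ᶠ[𝓝 z]
      ((fun w => Real.log (Complex.normSq (D ((chartAt ℂ p).symm w)))) -
        (r : ℝ) • (fun w => Real.log (Complex.normSq (S ((chartAt ℂ p).symm w))))) +
      ((r : ℝ) • (fun w => Real.log (hL.gram (fun _ : Fin 1 => σ) ((chartAt ℂ p).symm w))) +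
      (((fun w => Real.log (h.gram k ((chartAt ℂ p).symm w))) -
        fun w => Real.log (h.gram (Sum.elim k e) ((chartAt ℂ p).symm w))) +
      ((fun w => Real.log (h.gram k' ((chartAt ℂ p).symm w))) -
        fun w => Real.log (h.gram (Sum.elim k' f) ((chartAt ℂ p).symm w))))) := by
    filter_upwards [hcs.eventually (ho.mem_nhds hx), hD.continuousAt.eventually_ne hDx,
      hS.continuousAt.eventually_ne hS0] with w hw hDw hSw
    set y := (chartAt ℂ p).symm w
    have p0 := h.gram_pos (hf.left.left.linearIndependent y hw)
    have p1 := h.gram_pos (hf.left.whole.linearIndependent y hw)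
    have p2 := h.gram_pos (hf.right.left.linearIndependent y hw)
    have p3 := h.gram_pos (hf.right.whole.linearIndependent y hw)
    have p4 := hL.gram_pos (hf.line.linearIndependent y hw)
    have p5 : 0 < Complex.normSq (D y) := Complex.normSq_pos.2 hDw
    have p6 : 0 < Complex.normSq (S y) := Complex.normSq_pos.2 hSw
    have e1 : u y = Complex.normSq (D y) / Complex.normSq (S y) ^ r *
        hL.gram (fun _ : Fin 1 => σ) y ^ r * (h.gram k y / h.gram (Sum.elim k e) y) *
        (h.gram k' y / h.gram (Sum.elim k' f) y) := by
      have : u y = Complex.normSq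
          (Matrix.of fun i j => hL.form y (σ y) (Q.γ y (e i y) (f j y))).det *
          (h.gram k y / h.gram (Sum.elim k e) y) * (h.gram k' y / h.gram (Sum.elim k' f) y) /
          hL.gram (fun _ : Fin 1 => σ) y ^ r := by
        rw [hu y hw, pairingNorm, gram_line_frame, Fintype.card_fin, sumElim_eval, sumElim_eval]
        rfl
      rw [this, hform y hw hSw]
      simp only [map_mul, map_pow, map_div₀, Complex.normSq_ofReal, div_pow, mul_pow]
      field_simp
    simp only [Pi.add_apply, Pi.sub_apply, Pi.smul_apply, smul_eq_mul]
    rw [e1, Real.log_mul (by positivity) (by positivity),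
      Real.log_mul (by positivity) (by positivity), Real.log_mul (by positivity) (by positivity),
      Real.log_div (by positivity) (by positivity), Real.log_div (by positivity) (by positivity),
      Real.log_div (by positivity) (by positivity), Real.log_pow, Real.log_pow]
    ring
  have k1 := harmonicAt_log_normSq hD hDx
  have k2 := (harmonicAt_log_normSq hS hS0).const_smul (c := (r : ℝ))
  have c1 := hL.contDiffAt_log_gram hf.line hz hx
  have c2 := h.contDiffAt_log_gram hf.left.left hz hx
  have c3 := h.contDiffAt_log_gram hf.left.whole hz hx
  have c4 := h.contDiffAt_log_gram hf.right.left hz hx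
  have c5 := h.contDiffAt_log_gram hf.right.whole hz hx
  rw [(laplacian_congr_nhds hlog).self_of_nhds, laplacian_harmonic_add (k1.sub k2) c1 c2 c3 c4 c5,
    L.whole.chernForm_eq hL hf.line hz hx, K.chernForm_eq h hf.left.left hz hx,
    A.chernForm_eq h hf.left.whole hz hx, K'.chernForm_eq h hf.right.left hz hx,
    B.chernForm_eq h hf.right.whole hz hx]
  have := Real.pi_pos
  field_simp
  ring

variable [T2Space X] [CompactSpace X]

/-- If `γ` induces a generically nondegenerate pairing `A / K × B / K' → L` of rank `r`, then
`deg (A / K) + deg (B / K') ≤ r deg L`. -/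
theorem degree_add_degree_le (hKA : ∀ x, K.carrier x ≤ A.carrier x)
    (hKB : ∀ x, K'.carrier x ≤ B.carrier x)
    (hA : K.rank + r = A.rank) (hB : K'.rank + r = B.rank) (hK : Q.Annihilates K B)
    (hK' : Q.Annihilates A K') (hr : ∀ x, ∀ᶠ y in 𝓝[≠] x, Q.HasRank A B r y) :
    A.degree - K.degree + (B.degree - K'.degree) ≤ r * L.degree := by
  -- These are the metrics used in the definition of the degree. All four subbundles of `V` share
  -- the first, so independence of the metric never enters.
  let h := Classical.choice Q.V.nonempty_hermitianMetric
  let hL := Classical.choice L.nonempty_hermitianMetric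
  obtain ⟨u, hu⟩ := exists_pairing_function h hL hKA hKB hA hB hK hK'
  have hex := exists_pairingFrame hKA hKB hA hB
  let c₁ : X → ℂ → ℝ := fun p z => r * L.whole.chernForm hL p z
  let c₂ : X → ℂ → ℝ := fun p z => K.chernForm h p z + -1 * A.chernForm h p z
  let c₃ : X → ℂ → ℝ := fun p z => K'.chernForm h p z + -1 * B.chernForm h p z
  have hc₁ : ∀ p, ContinuousOn (c₁ p) (chartAt ℂ p).target := fun p =>
    continuousOn_const.mul (L.whole.continuousOn_chernForm hL p)
  have hA' : ∀ p, ContinuousOn (fun z => -1 * A.chernForm h p z) (chartAt ℂ p).target := fun p =>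
    continuousOn_const.mul (A.continuousOn_chernForm h p)
  have hB' : ∀ p, ContinuousOn (fun z => -1 * B.chernForm h p z) (chartAt ℂ p).target := fun p =>
    continuousOn_const.mul (B.continuousOn_chernForm h p)
  have hc₂ : ∀ p, ContinuousOn (c₂ p) (chartAt ℂ p).target := fun p =>
    (K.continuousOn_chernForm h p).add (hA' p)
  have hc₃ : ∀ p, ContinuousOn (c₃ p) (chartAt ℂ p).target := fun p =>
    (K'.continuousOn_chernForm h p).add (hB' p)
  have key := surfaceIntegral_le_zero_of_laplacian_log (u := u)
    (a := fun p z => -(4 * Real.pi) * (c₁ p z + c₂ p z + c₃ p z))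
    (fun x => by
      obtain ⟨U, σ, k, e, k', f, hx, hf⟩ := hex x
      exact contMDiffAt_pairing_function h hL hf (hu _ _ _ _ _ _ hf) hx)
    (fun x => by
      obtain ⟨U, σ, k, e, k', f, hx, hf⟩ := hex x
      rw [hu _ _ _ _ _ _ hf x hx]
      exact pairingNorm_nonneg (h.conj_symm x) (h.pos x) (hL.pos x) (hf.left.isAdapted hx)
        (hf.right.isAdapted hx) (line_frame_spec hf.line hx).1)
    (fun x => by
      filter_upwards [hr x] with y hy
      obtain ⟨U, σ, k, e, k', f, hx, hf⟩ := hex y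
      obtain ⟨v, w, l, hv, hw, hdet⟩ := hy
      rw [hu _ _ _ _ _ _ hf y hx]
      obtain ⟨h1, h2⟩ := line_frame_spec hf.line hx
      exact pairingNorm_ne_zero (h.conj_symm y) (h.pos y) (hL.pos y) (hK y) (hK' y)
        (hf.left.isAdapted hx) (hf.right.isAdapted hx) h1 h2 hv hw hdet)
    (fun p => continuousOn_const.mul (((hc₁ p).add (hc₂ p)).add (hc₃ p)))
    (fun p z hz hne => by
      obtain ⟨U, σ, k, e, k', f, hx, hf⟩ := hex ((chartAt ℂ p).symm z)
      rw [laplacian_log_pairing_function h hL hf (hu _ _ _ _ _ _ hf) hz hx hne]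
      ring)
  rw [surfaceIntegral_const_mul, surfaceIntegral_add (a := fun p z => c₁ p z + c₂ p z)
      (fun p => (hc₁ p).add (hc₂ p)) hc₃,
    surfaceIntegral_add hc₁ hc₂, surfaceIntegral_const_mul,
    surfaceIntegral_add (K.continuousOn_chernForm h) hA', surfaceIntegral_const_mul,
    surfaceIntegral_add (K'.continuousOn_chernForm h) hB', surfaceIntegral_const_mul] at key
  have hpi := Real.pi_pos
  have : 0 ≤ r * L.degree + (K.degree + -1 * A.degree) + (K'.degree + -1 * B.degree) := by
    by_contra hneg
    have := mul_pos_of_neg_of_neg (neg_lt_zero.2 (by positivity : 0 < 4 * Real.pi))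
      (not_le.1 hneg)
    exact absurd key (not_le.2 this)
  linarith

end QuadricBundle

/-! ### Minors and linear algebra -/

section LinearAlgebra

/-- An invertible product of size `r` forces `M` to have rank at least `r`; independent rows are
chosen first, then columns. -/
theorem exists_minor_of_mul_det_ne_zero {a b r : ℕ} (M : Matrix (Fin a) (Fin b) ℂ)
    (P : Matrix (Fin r) (Fin a) ℂ) (R : Matrix (Fin b) (Fin r) ℂ) (h : (P * M * R).det ≠ 0) :
    ∃ (f : Fin r → Fin a) (g : Fin r → Fin b), (M.submatrix f g).det ≠ 0 := by
  have hr : r ≤ M.rank := by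
    have h1 : (P * M * R).rank = r := by
      rw [Matrix.rank_of_isUnit _ ((Matrix.isUnit_iff_isUnit_det _).2 h.isUnit), Fintype.card_fin]
    calc r = (P * M * R).rank := h1.symm
      _ ≤ (P * M).rank := Matrix.rank_mul_le_left _ _
      _ ≤ M.rank := Matrix.rank_mul_le_right _ _
  obtain ⟨f, hf, -⟩ := exists_comp_basis_of_span rfl M.rank_eq_finrank_span_row.symm
  have hf' : LinearIndependent ℂ (M.row ∘ (f ∘ Fin.castLE hr)) :=
    hf.comp _ (Fin.castLE_injective hr)
  obtain ⟨g, hg⟩ := exists_minor_ne_zero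
    (hf'.map' (WithLp.linearEquiv 2 ℂ (Fin b → ℂ)).symm.toLinearMap (LinearEquiv.ker _))
  exact ⟨f ∘ Fin.castLE hr, g, hg⟩

variable {W : Type*} [AddCommGroup W] [Module ℂ W] {ρ r p : ℕ} {a : Fin ρ → W}
  {f : Fin r → Fin ρ} {g : Fin p → Fin ρ}

/-- Modulo the span of the `a (f i)` the corrected vectors are the `a (g j)`. -/
theorem linearIndependent_sub_combination (ha : LinearIndependent ℂ a)
    (hg : Function.Injective g) (hfg : Set.range g = (Set.range f)ᶜ) (c : Fin r → Fin p → ℂ) :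
    LinearIndependent ℂ fun j => a (g j) - ∑ i, c i j • a (f i) := by
  let S := Submodule.span ℂ (Set.range (a ∘ f))
  have h1 : LinearIndependent ℂ (S.mkQ ∘ (a ∘ g)) := by
    refine (ha.comp g hg).map ?_
    simp only [S, Submodule.ker_mkQ, Set.range_comp]
    refine ha.disjoint_span_image ?_
    rw [hfg]
    exact disjoint_compl_left
  refine LinearIndependent.of_comp S.mkQ ?_
  convert! h1 using 1
  funext j
  have : ∑ i, c i j • a (f i) ∈ S :=
    Submodule.sum_mem _ fun i _ => S.smul_mem _ (Submodule.subset_span ⟨i, rfl⟩)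
  simp only [Function.comp_apply, map_sub, Submodule.mkQ_apply]
  rw [(Submodule.Quotient.mk_eq_zero S).2 this, sub_zero]

theorem span_le_sup_sub_combination (hfg : Set.range g = (Set.range f)ᶜ) (c : Fin r → Fin p → ℂ) :
    Submodule.span ℂ (Set.range a) ≤
      Submodule.span ℂ (Set.range fun j => a (g j) - ∑ i, c i j • a (f i)) ⊔
        Submodule.span ℂ (Set.range (a ∘ f)) := by
  have hf : ∀ i, a (f i) ∈ Submodule.span ℂ (Set.range (a ∘ f)) := fun i =>
    Submodule.subset_span ⟨i, rfl⟩
  refine Submodule.span_le.2 ?_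
  rintro _ ⟨l, rfl⟩
  by_cases hl : l ∈ Set.range f
  · obtain ⟨i, rfl⟩ := hl
    exact Submodule.mem_sup_right (hf i)
  · have : l ∈ Set.range g := by rw [hfg]; exact hl
    obtain ⟨j, rfl⟩ := this
    have e : a (g j) = (a (g j) - ∑ i, c i j • a (f i)) + ∑ i, c i j • a (f i) := by simp
    rw [SetLike.mem_coe, e]
    exact Submodule.add_mem_sup (Submodule.subset_span ⟨j, rfl⟩)
      (Submodule.sum_mem _ fun i _ => Submodule.smul_mem _ _ (hf i))

/-- Cramer's rule for the rows of a matrix. -/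
theorem sum_det_updateRow_mul {r : ℕ} (M : Matrix (Fin r) (Fin r) ℂ) (b : Fin r → ℂ) (l : Fin r) :
    ∑ i, (M.updateRow i b).det * M i l = M.det * b l := by
  have h := congrFun (Matrix.mulVec_cramer M.transpose b) l
  simp only [Matrix.mulVec, dotProduct, Matrix.cramer_transpose_apply, Matrix.det_transpose,
    Pi.smul_apply, smul_eq_mul, Matrix.transpose_apply] at h
  rw [← h]
  exact Finset.sum_congr rfl fun i _ => mul_comm _ _

end LinearAlgebra

/-! ### Holomorphic functions near a point of a Riemann surface -/

section Local

/-- Divide both functions by the power of the coordinate given by the order of `G`; what remains of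
`G` is invertible. -/
theorem AnalyticAt.exists_eq_mul {F G : ℂ → ℂ} {z : ℂ} (hF : AnalyticAt ℂ F z)
    (hG : AnalyticAt ℂ G z) (h0 : analyticOrderAt G z ≠ ⊤)
    (h : analyticOrderAt G z ≤ analyticOrderAt F z) :
    ∃ c : ℂ → ℂ, AnalyticAt ℂ c z ∧ ∀ᶠ w in 𝓝 z, F w = c w * G w := by
  obtain ⟨m, hm⟩ := ENat.ne_top_iff_exists.1 h0
  obtain ⟨g, hg, hg0, hge⟩ := (hG.analyticOrderAt_eq_natCast).1 hm.symm
  rw [← hm] at h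
  obtain ⟨f, hf, hfe⟩ := (natCast_le_analyticOrderAt hF).1 h
  refine ⟨fun w => f w / g w, hf.div hg hg0, ?_⟩
  filter_upwards [hge, hfe, hg.continuousAt.eventually_ne hg0] with w h1 h2 h3
  rw [h1, h2]
  simp only [smul_eq_mul]
  field_simp

variable {X : Type*} [TopologicalSpace X] [ChartedSpace ℂ X]

theorem tendsto_chart_punctured (x : X) :
    Filter.Tendsto (chartAt ℂ x) (𝓝[≠] x) (𝓝[≠] (chartAt ℂ x x)) := by
  have hx := mem_chart_source ℂ x
  refine tendsto_nhdsWithin_iff.2 ⟨((chartAt ℂ x).continuousAt hx).mono_left nhdsWithin_le_nhds, ?_⟩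
  filter_upwards [self_mem_nhdsWithin, nhdsWithin_le_nhds ((chartAt ℂ x).open_source.mem_nhds hx)]
    with y hy hys h
  exact hy ((chartAt ℂ x).injOn hys hx h)

theorem punctured_nhds_neBot (x : X) : (𝓝[≠] x).NeBot := by
  have hx := mem_chart_source ℂ x
  have ht := mem_chart_target ℂ x
  have h : Filter.Tendsto (chartAt ℂ x).symm (𝓝[≠] (chartAt ℂ x x)) (𝓝[≠] x) := by
    have hc := (chartAt ℂ x).symm.continuousAt ht
    rw [ContinuousAt, (chartAt ℂ x).left_inv hx] at hc
    refine tendsto_nhdsWithin_iff.2 ⟨hc.mono_left nhdsWithin_le_nhds, ?_⟩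
    filter_upwards [self_mem_nhdsWithin, nhdsWithin_le_nhds
      ((chartAt ℂ x).open_target.mem_nhds ht)] with w hw hwt h
    exact hw (by
      rw [Set.mem_singleton_iff, ← (chartAt ℂ x).right_inv hwt, h])
  exact h.neBot

theorem eventually_of_chart {P : X → Prop} {x : X}
    (h : ∀ᶠ w in 𝓝 (chartAt ℂ x x), P ((chartAt ℂ x).symm w)) : ∀ᶠ y in 𝓝 x, P y := by
  have hx := mem_chart_source ℂ x
  filter_upwards [((chartAt ℂ x).continuousAt hx).eventually h,
    (chartAt ℂ x).open_source.mem_nhds hx] with y hy hys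
  rwa [(chartAt ℂ x).left_inv hys] at hy

/-- The order of vanishing at `x` of a holomorphic function. -/
def vanishingOrder (f : X → ℂ) (x : X) : ℕ∞ :=
  analyticOrderAt (fun w => f ((chartAt ℂ x).symm w)) (chartAt ℂ x x)

theorem vanishingOrder_eq_top {f : X → ℂ} {x : X} :
    vanishingOrder f x = ⊤ ↔ ∀ᶠ y in 𝓝 x, f y = 0 := by
  refine ⟨fun h => eventually_of_chart (analyticOrderAt_eq_top.1 h), fun h => ?_⟩
  have hc := (chartAt ℂ x).symm.continuousAt (mem_chart_target ℂ x)
  rw [ContinuousAt, (chartAt ℂ x).left_inv (mem_chart_source ℂ x)] at hc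
  exact analyticOrderAt_eq_top.2 (hc.eventually h)

variable [IsManifold 𝓘(ℂ) ω X]

theorem ContMDiffAt.analyticAt_chart {f : X → ℂ} {x : X} (hf : ContMDiffAt 𝓘(ℂ) 𝓘(ℂ) ω f x) :
    AnalyticAt ℂ (fun w => f ((chartAt ℂ x).symm w)) (chartAt ℂ x x) :=
  ContMDiffAt.analyticAt_comp_chart_symm (mem_chart_target ℂ x)
    (by rwa [(chartAt ℂ x).left_inv (mem_chart_source ℂ x)])

theorem eventually_eq_zero_or_ne_zero {f : X → ℂ} {x : X}
    (hf : ContMDiffAt 𝓘(ℂ) 𝓘(ℂ) ω f x) :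
    (∀ᶠ y in 𝓝 x, f y = 0) ∨ ∀ᶠ y in 𝓝[≠] x, f y ≠ 0 := by
  refine hf.analyticAt_chart.eventually_eq_zero_or_eventually_ne_zero.imp
    (fun h => eventually_of_chart h) fun h => ?_
  filter_upwards [(tendsto_chart_punctured x).eventually h, nhdsWithin_le_nhds
    ((chartAt ℂ x).open_source.mem_nhds (mem_chart_source ℂ x))] with y hy hys
  rwa [(chartAt ℂ x).left_inv hys] at hy

theorem exists_holomorphic_quotient {F G : X → ℂ} {x : X} (hF : ContMDiffAt 𝓘(ℂ) 𝓘(ℂ) ω F x)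
    (hG : ContMDiffAt 𝓘(ℂ) 𝓘(ℂ) ω G x) (h0 : vanishingOrder G x ≠ ⊤)
    (h : vanishingOrder G x ≤ vanishingOrder F x) :
    ∃ c : X → ℂ, ∀ᶠ y in 𝓝 x, ContMDiffAt 𝓘(ℂ) 𝓘(ℂ) ω c y ∧ F y = c y * G y := by
  obtain ⟨c, hc, hce⟩ := hF.analyticAt_chart.exists_eq_mul hG.analyticAt_chart h0 h
  have hx := mem_chart_source ℂ x
  have hcx := (chartAt ℂ x).continuousAt hx
  refine ⟨fun y => c (chartAt ℂ x y), ?_⟩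
  filter_upwards [hcx.eventually hce, hcx.eventually hc.eventually_analyticAt,
    (chartAt ℂ x).open_source.mem_nhds hx] with y h1 h2 hys
  refine ⟨?_, by rwa [(chartAt ℂ x).left_inv hys] at h1⟩
  exact h2.contDiffAt.contMDiffAt.comp y ((contMDiffOn_chart (I := 𝓘(ℂ)) (n := ω)
    (x := x)).contMDiffAt ((chartAt ℂ x).open_source.mem_nhds hys))

end Local

/-! ### The kernel of a pairing of subbundles -/

namespace QuadricBundle

open HolVectorBundle

variable {X : Type*} [TopologicalSpace X] [ChartedSpace ℂ X] {n : ℕ} {L : HolVectorBundle X 1}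
  {Q : QuadricBundle L n} {A B : Q.V.Subbundle} {r : ℕ}

theorem HasRank.symm {y : X} (h : Q.HasRank A B r y) : Q.HasRank B A r y := by
  obtain ⟨v, w, l, hv, hw, hd⟩ := h
  refine ⟨w, v, l, hw, hv, ?_⟩
  rw [← Matrix.det_transpose]
  convert! hd using 2
  ext i j
  simp [Q.symm y (w j)]

theorem HasRank.le_rank {y : X} (h : Q.HasRank A B r y) : r ≤ A.rank := by
  obtain ⟨v, w, l, hv, hw, hd⟩ := h
  have hli : LinearIndependent ℂ v := by
    refine Fintype.linearIndependent_iff.2 fun c hc => ?_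
    refine congrFun (Matrix.eq_zero_of_vecMul_eq_zero hd (v := c) ?_)
    funext j
    have := congrArg (fun x => l (Q.γ y x (w j))) hc
    simpa [Matrix.vecMul, dotProduct] using this
  have hli' : LinearIndependent ℂ fun i => (⟨v i, hv i⟩ : A.carrier y) :=
    LinearIndependent.of_comp (A.carrier y).subtype hli
  have := hli'.fintype_card_le_finrank
  rwa [Fintype.card_fin, A.finrank_carrier] at this

theorem hasRank_zero (Q : QuadricBundle L n) (A B : Q.V.Subbundle) (y : X) : Q.HasRank A B 0 y :=
  ⟨Fin.elim0, Fin.elim0, 0, fun i => i.elim0, fun i => i.elim0, by simp⟩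

/-- The matrix of the pairing in families of sections and the preferred coordinate of `L`. -/
def pairingMatrix (Q : QuadricBundle L n) (x₀ : X) {α β : ℕ} (a : Fin α → ∀ x, Q.V.Fiber x)
    (b : Fin β → ∀ x, Q.V.Fiber x) (y : X) : Matrix (Fin α) (Fin β) ℂ :=
  Matrix.of fun i j => L.coord x₀ y (Q.γ y (a i y) (b j y)) 0

theorem contMDiffAt_pairingMatrix {x₀ : X} {α β : ℕ} {a : Fin α → ∀ x, Q.V.Fiber x}
    {b : Fin β → ∀ x, Q.V.Fiber x} {U : Set X} (hU : IsOpen U) (ha : ∀ i, Q.V.IsHolSection (a i) U)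
    (hb : ∀ i, Q.V.IsHolSection (b i) U) {y : X} (hy : y ∈ U) (hy' : y ∈ L.coordNhd x₀)
    (i : Fin α) (j : Fin β) :
    ContMDiffAt 𝓘(ℂ) 𝓘(ℂ) ω (fun y => Q.pairingMatrix x₀ a b y i j) y :=
  (Q.holomorphic U (a i) (b j) hU (ha i) (hb j)).contMDiffAt_coord_apply hU hy hy' 0

theorem coord_line_eq_zero {x₀ y : X} (hy : y ∈ L.coordNhd x₀) {z : L.Fiber y}
    (h : L.coord x₀ y z 0 = 0) : z = 0 := by
  apply (coord_bijective hy).1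
  ext i
  rw [Subsingleton.elim i 0, h]
  simp

/-- Arbitrary test vectors are replaced by frame members, so the rank is controlled by finitely many
holomorphic minors. -/
theorem exists_minor_iff {x₀ y : X} (hy : y ∈ L.coordNhd x₀) {U : Set X}
    {a : Fin A.rank → ∀ x, Q.V.Fiber x} {b : Fin B.rank → ∀ x, Q.V.Fiber x}
    (ha : Q.V.IsLocalFrame A.carrier a U) (hb : Q.V.IsLocalFrame B.carrier b U) (hyU : y ∈ U) :
    Q.HasRank A B r y ↔
      ∃ f g, ((Q.pairingMatrix x₀ a b y).submatrix (f : Fin r → _) (g : Fin r → _)).det ≠ 0 := by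
  constructor
  · rintro ⟨v, w, l, hv, hw, hd⟩
    have hv' : ∀ i, ∃ c : Fin A.rank → ℂ, ∑ j, c j • a j y = v i := fun i =>
      (Submodule.mem_span_range_iff_exists_fun ℂ).1 (by rw [ha.span_eq y hyU]; exact hv i)
    have hw' : ∀ i, ∃ c : Fin B.rank → ℂ, ∑ j, c j • b j y = w i := fun i =>
      (Submodule.mem_span_range_iff_exists_fun ℂ).1 (by rw [hb.span_eq y hyU]; exact hw i)
    choose P hP using hv'
    choose R hR using hw'
    obtain ⟨z, hz⟩ := (coord_bijective hy).2 (EuclideanSpace.single 0 1)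
    have hl : ∀ t : L.Fiber y, l t = l z * L.coord x₀ y t 0 := by
      intro t
      have : t = L.coord x₀ y t 0 • z := by
        apply (coord_bijective hy).1
        ext i
        rw [Subsingleton.elim i 0, map_smul, hz]
        simp
      conv_lhs => rw [this, map_smul, smul_eq_mul, mul_comm]
    have e : (Matrix.of fun i j => l (Q.γ y (v i) (w j))) =
        l z • (Matrix.of P * Q.pairingMatrix x₀ a b y * (Matrix.of R).transpose) := by
      ext i j
      rw [Matrix.of_apply, hl, ← hP, ← hR]
      simp only [map_sum, map_smul, LinearMap.sum_apply, LinearMap.smul_apply, Matrix.smul_apply,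
        Matrix.mul_apply, Matrix.of_apply, Matrix.transpose_apply, pairingMatrix, smul_eq_mul,
        Finset.sum_mul, WithLp.ofLp_sum, Finset.sum_apply, PiLp.smul_apply, Finset.mul_sum]
      refine Finset.sum_congr rfl fun _ _ => Finset.sum_congr rfl fun _ _ => ?_
      ring
    rw [e, Matrix.det_smul] at hd
    exact exists_minor_of_mul_det_ne_zero _ _ _ (right_ne_zero_of_mul hd)
  · rintro ⟨f, g, hd⟩
    refine ⟨fun i => a (f i) y, fun i => b (g i) y,
      (EuclideanSpace.proj (𝕜 := ℂ) (0 : Fin 1)).toLinearMap.comp (L.coord x₀ y),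
      fun i => ha.mem hyU _, fun i => hb.mem hyU _, ?_⟩
    convert! hd using 2

/-- If the rank of the pairing is at most `r` and some minor of size `r` does not vanish, then a
vector that pairs to zero with the columns of the minor pairs to zero with everything. -/
theorem pairing_eq_zero_of_minor {y : X} (hr : ¬ Q.HasRank A B (r + 1) y)
    {v w : Fin r → Q.V.Fiber y} {l : L.Fiber y →ₗ[ℂ] ℂ} (hl : ∀ z, l z = 0 → z = 0)
    (hv : ∀ i, v i ∈ A.carrier y) (hw : ∀ i, w i ∈ B.carrier y)
    (hd : (Matrix.of fun i j => l (Q.γ y (v i) (w j))).det ≠ 0) {x : Q.V.Fiber y}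
    (hx : x ∈ A.carrier y) (h0 : ∀ j, Q.γ y x (w j) = 0) {t : Q.V.Fiber y}
    (ht : t ∈ B.carrier y) : Q.γ y x t = 0 := by
  by_contra hne
  apply hr
  -- The minor bordered by `x` and `t` has a first row that vanishes beyond its first entry, so it
  -- is the old minor times the value of `l` on `γ x t`.
  refine ⟨Fin.cons x v, Fin.cons t w, l, Fin.cases hx hv, Fin.cases ht hw, ?_⟩
  rw [Matrix.det_succ_row_zero, Fin.sum_univ_succ]
  simp only [Matrix.of_apply, Fin.cons_zero, Fin.cons_succ, h0, map_zero]
  simp only [mul_zero, zero_mul, Finset.sum_const_zero, add_zero, Fin.val_zero, pow_zero, one_mul]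
  refine mul_ne_zero (fun h => hne (hl _ h)) ?_
  convert! hd using 2

variable (Q A B) in
/-- The kernel of the pairing of `A` with `B`: the values of the holomorphic sections of `A` that
pair to zero with `B`. -/
def kernelFiber (x : X) : Submodule ℂ (Q.V.Fiber x) where
  carrier := {v | ∃ (U : Set X) (s : ∀ x, Q.V.Fiber x), IsOpen U ∧ x ∈ U ∧ Q.V.IsHolSection s U ∧
    (∀ y ∈ U, s y ∈ A.carrier y ∧ ∀ w ∈ B.carrier y, Q.γ y (s y) w = 0) ∧ s x = v}
  zero_mem' := ⟨Set.univ, fun _ => 0, isOpen_univ, trivial, isHolSection_zero _,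
    fun _ _ => ⟨Submodule.zero_mem _, by simp⟩, rfl⟩
  add_mem' := by
    rintro _ _ ⟨U, s, hU, hx, hs, h, rfl⟩ ⟨U', s', hU', hx', hs', h', rfl⟩
    exact ⟨U ∩ U', fun x => s x + s' x, hU.inter hU', ⟨hx, hx'⟩,
      (hs.mono Set.inter_subset_left).add (hs'.mono Set.inter_subset_right),
      fun y hy => ⟨Submodule.add_mem _ (h y hy.1).1 (h' y hy.2).1, fun w hw => by
        rw [map_add, LinearMap.add_apply, (h y hy.1).2 w hw, (h' y hy.2).2 w hw, add_zero]⟩, rfl⟩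
  smul_mem' := by
    rintro c _ ⟨U, s, hU, hx, hs, h, rfl⟩
    exact ⟨U, fun x => c • s x, hU, hx, hs.smul contMDiffOn_const,
      fun y hy => ⟨Submodule.smul_mem _ c (h y hy).1, fun w hw => by
        rw [map_smul, LinearMap.smul_apply, (h y hy).2 w hw, smul_zero]⟩, rfl⟩

theorem kernelFiber_le (x : X) : Q.kernelFiber A B x ≤ A.carrier x := by
  rintro _ ⟨U, s, -, hx, -, h, rfl⟩
  exact (h x hx).1

theorem pairing_kernelFiber {x : X} {v : Q.V.Fiber x} (hv : v ∈ Q.kernelFiber A B x)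
    {w : Q.V.Fiber x} (hw : w ∈ B.carrier x) : Q.γ x v w = 0 := by
  obtain ⟨U, s, -, hx, -, h, rfl⟩ := hv
  exact (h x hx).2 w hw

theorem le_kernelFiber {C : Q.V.Subbundle} (hC : ∀ x, C.carrier x ≤ A.carrier x)
    (h : Q.Annihilates C B) (x : X) : C.carrier x ≤ Q.kernelFiber A B x := by
  intro v hv
  obtain ⟨U, hx, hc⟩ := C.isLocalFrame_frameAt x
  rw [← hc.span_eq x hx, Submodule.mem_span_range_iff_exists_fun] at hv
  obtain ⟨c, rfl⟩ := hv
  have hmem : ∀ y ∈ U, ∑ i, c i • C.frameAt x i y ∈ C.carrier y := fun y hy =>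
    Submodule.sum_mem _ fun i _ => Submodule.smul_mem _ _ (hc.mem hy i)
  exact ⟨U, fun y => ∑ i, c i • C.frameAt x i y, hc.isOpen, hx,
    IsHolSection.sum fun i => (hc.isHolSection i).smul contMDiffOn_const,
    fun y hy => ⟨hC y (hmem y hy), fun w hw => h y _ (hmem y hy) w hw⟩, rfl⟩

variable [IsManifold 𝓘(ℂ) ω X]

/-- Each of the finitely many minors vanishes identically near `x` or has no zero in a punctured
neighbourhood. -/
theorem eventually_hasRank_or (x : X) :
    (∀ᶠ y in 𝓝 x, ¬ Q.HasRank A B r y) ∨ ∀ᶠ y in 𝓝[≠] x, Q.HasRank A B r y := by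
  obtain ⟨U₁, hx₁, ha⟩ := A.isLocalFrame_frameAt x
  obtain ⟨U₂, hx₂, hb⟩ := B.isLocalFrame_frameAt x
  have ho := ha.isOpen.inter hb.isOpen
  replace ha := ha.mono ho Set.inter_subset_left
  replace hb := hb.mono ho Set.inter_subset_right
  have hmem : ∀ᶠ y in 𝓝 x, y ∈ U₁ ∩ U₂ ∧ y ∈ L.coordNhd x :=
    Filter.Eventually.and (ho.mem_nhds ⟨hx₁, hx₂⟩) ((isOpen_coordNhd x).mem_nhds (mem_coordNhd x))
  have hdich := fun (f : Fin r → Fin A.rank) (g : Fin r → Fin B.rank) =>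
    eventually_eq_zero_or_ne_zero (ContMDiffAt.matrix_det fun i j =>
      contMDiffAt_pairingMatrix ho ha.isHolSection hb.isHolSection ⟨hx₁, hx₂⟩
        (mem_coordNhd (V := L) x) (f i) (g j))
  by_cases h : ∃ f g, ∀ᶠ y in 𝓝[≠] x, (Matrix.of fun i j => Q.pairingMatrix x (A.frameAt x)
      (B.frameAt x) y ((f : Fin r → _) i) ((g : Fin r → _) j)).det ≠ 0
  · obtain ⟨f, g, h⟩ := h
    right
    filter_upwards [h, nhdsWithin_le_nhds hmem] with y hy hyU
    exact (exists_minor_iff hyU.2 ha hb hyU.1).2 ⟨f, g, hy⟩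
  · left
    push Not at h
    have hz : ∀ᶠ y in 𝓝 x, ∀ f g, (Matrix.of fun i j => Q.pairingMatrix x (A.frameAt x)
        (B.frameAt x) y ((f : Fin r → _) i) ((g : Fin r → _) j)).det = 0 :=
      Filter.eventually_all.2 fun f => Filter.eventually_all.2 fun g =>
        (hdich f g).resolve_right fun h1 => (h f g).elim h1
    filter_upwards [hz, hmem] with y hy hyU hr
    obtain ⟨f, g, hd⟩ := (exists_minor_iff hyU.2 ha hb hyU.1).1 hr
    exact hd (hy f g)

/-- Both alternatives of `eventually_hasRank_or` are open conditions on the point and exclude each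
other, so connectedness selects one for the whole surface. -/
theorem eventually_hasRank [T1Space X] [PreconnectedSpace X] {x₀ : X}
    (h : Q.HasRank A B r x₀) (x : X) : ∀ᶠ y in 𝓝[≠] x, Q.HasRank A B r y := by
  let S : Set X := {x | ∀ᶠ y in 𝓝 x, ¬ Q.HasRank A B r y}
  let T : Set X := {x | ∀ᶠ y in 𝓝[≠] x, Q.HasRank A B r y}
  have hS : IsOpen S := isOpen_iff_mem_nhds.2 fun x hx => hx.eventually_nhds
  have hT : IsOpen T := by
    refine isOpen_iff_mem_nhds.2 fun x hx => ?_
    have h1 : ∀ᶠ y in 𝓝[≠] x, y ∈ T := by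
      filter_upwards [eventually_nhdsNE_eventually_nhds_iff.2 hx] with y hy
      exact nhdsWithin_le_nhds hy
    have h2 : ∀ᶠ y in 𝓝 x, y ∈ T := by
      rw [eventually_nhdsWithin_iff] at h1
      filter_upwards [h1] with y hy
      by_cases e : y = x
      · rwa [e]
      · exact hy e
    exact h2
  have hST : T = Sᶜ := by
    ext x
    refine ⟨fun h1 h2 => ?_, fun h1 => (eventually_hasRank_or x).resolve_left h1⟩
    have := punctured_nhds_neBot x
    have h1' : ∀ᶠ y in 𝓝[≠] x, Q.HasRank A B r y := h1
    have h2' : ∀ᶠ y in 𝓝 x, ¬ Q.HasRank A B r y := h2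
    obtain ⟨y, hy, hy'⟩ := (h1'.and (h2'.filter_mono nhdsWithin_le_nhds)).exists
    exact hy' hy
  have hcl : IsClopen S := ⟨⟨hST ▸ hT⟩, hS⟩
  rcases isClopen_iff.1 hcl with h1 | h1
  · have : x ∈ T := by rw [hST, h1]; simp
    exact this
  · have : x₀ ∈ S := by rw [h1]; trivial
    exact absurd h this.self_of_nhds

/-- The largest rank attained at some point is attained off a discrete set. -/
theorem exists_generic_rank [T1Space X] [ConnectedSpace X] (Q : QuadricBundle L n)
    (A B : Q.V.Subbundle) :
    ∃ r, (∀ x, ∀ᶠ y in 𝓝[≠] x, Q.HasRank A B r y) ∧ ∀ y, ¬ Q.HasRank A B (r + 1) y := by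
  classical
  have hex : ∃ r, ∀ y, ¬ Q.HasRank A B (r + 1) y :=
    ⟨A.rank, fun y hy => by have := hy.le_rank; omega⟩
  refine ⟨Nat.find hex, ?_, Nat.find_spec hex⟩
  have h : ∃ x₀, Q.HasRank A B (Nat.find hex) x₀ := by
    rcases Nat.eq_zero_or_pos (Nat.find hex) with h0 | h0
    · rw [h0]
      exact ⟨Classical.arbitrary X, hasRank_zero Q A B _⟩
    · have := Nat.find_min hex (Nat.sub_lt h0 one_pos)
      push Not at this
      rwa [show Nat.find hex - 1 + 1 = Nat.find hex from Nat.sub_add_cancel h0] at this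
  obtain ⟨x₀, hx₀⟩ := h
  exact fun x => eventually_hasRank hx₀ x

end QuadricBundle

/-! ### Local frames of the kernel -/

namespace QuadricBundle

open HolVectorBundle

variable {X : Type*} [TopologicalSpace X] [ChartedSpace ℂ X] {n : ℕ} {L : HolVectorBundle X 1}
  {Q : QuadricBundle L n} {A B : Q.V.Subbundle} {r : ℕ} [IsManifold 𝓘(ℂ) ω X]

/-- Generically the kernel is found by solving for the remaining members of a frame of `A` in terms
of the rows of a nonzero minor. The coefficients are quotients of minors; with a denominator of
lowest vanishing order they extend over `x₀`, and so do the resulting sections. -/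
theorem exists_kernel_frame (hgen : ∀ x, ∀ᶠ y in 𝓝[≠] x, Q.HasRank A B r y)
    (hmax : ∀ y, ¬ Q.HasRank A B (r + 1) y) {p : ℕ} (hp : p + r = A.rank) (x₀ : X) :
    ∃ U, x₀ ∈ U ∧ ∃ s : Fin p → ∀ y, Q.V.Fiber y, Q.V.IsFrame (Q.kernelFiber A B) s U := by
  have := punctured_nhds_neBot x₀
  obtain ⟨U₁, hx₁, ha⟩ := A.isLocalFrame_frameAt x₀
  obtain ⟨U₂, hx₂, hb⟩ := B.isLocalFrame_frameAt x₀
  have hU := ha.isOpen.inter hb.isOpen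
  replace ha := ha.mono hU Set.inter_subset_left
  replace hb := hb.mono hU Set.inter_subset_right
  have hxU : x₀ ∈ U₁ ∩ U₂ := ⟨hx₁, hx₂⟩
  clear hx₁ hx₂
  generalize U₁ ∩ U₂ = U at *
  generalize A.frameAt x₀ = a at *
  generalize B.frameAt x₀ = b at *
  have hxc : x₀ ∈ L.coordNhd x₀ := mem_coordNhd x₀
  let m : X → Matrix (Fin A.rank) (Fin B.rank) ℂ := Q.pairingMatrix x₀ a b
  let μ : (Fin r → Fin A.rank) → (Fin r → Fin B.rank) → X → ℂ := fun f g y =>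
    (Matrix.of fun i j => m y (f i) (g j)).det
  have hμ : ∀ f g, ContMDiffAt 𝓘(ℂ) 𝓘(ℂ) ω (μ f g) x₀ := fun f g =>
    ContMDiffAt.matrix_det fun i j =>
      contMDiffAt_pairingMatrix hU ha.isHolSection hb.isHolSection hxU hxc (f i) (g j)
  have hnear : ∀ᶠ y in 𝓝 x₀, y ∈ U ∧ y ∈ L.coordNhd x₀ :=
    Filter.Eventually.and (hU.mem_nhds hxU) ((isOpen_coordNhd x₀).mem_nhds hxc)
  have hminor : ∀ᶠ y in 𝓝[≠] x₀, ∃ f g, μ f g y ≠ 0 := by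
    filter_upwards [hgen x₀, nhdsWithin_le_nhds hnear] with y hy hyU
    exact (exists_minor_iff hyU.2 ha hb hyU.1).1 hy
  -- a minor that vanishes to the lowest order at `x₀`
  have hne : Nonempty ((Fin r → Fin A.rank) × (Fin r → Fin B.rank)) := by
    obtain ⟨y, f, g, -⟩ := hminor.exists
    exact ⟨(f, g)⟩
  obtain ⟨⟨f, g⟩, hmin⟩ := Finite.exists_min
    fun q : (Fin r → Fin A.rank) × (Fin r → Fin B.rank) => vanishingOrder (μ q.1 q.2) x₀
  simp only [Prod.forall] at hmin
  have htop : vanishingOrder (μ f g) x₀ ≠ ⊤ := by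
    intro h
    have hz : ∀ᶠ y in 𝓝 x₀, ∀ f g, μ f g y = 0 := Filter.eventually_all.2 fun f' =>
      Filter.eventually_all.2 fun g' =>
        vanishingOrder_eq_top.1 (top_le_iff.1 (h ▸ hmin f' g'))
    obtain ⟨y, ⟨f', g', h1⟩, h2⟩ := (hminor.and (hz.filter_mono nhdsWithin_le_nhds)).exists
    exact h1 (h2 f' g')
  have hμ0 : ∀ᶠ y in 𝓝[≠] x₀, μ f g y ≠ 0 :=
    (eventually_eq_zero_or_ne_zero (hμ f g)).resolve_left fun h =>
      htop (vanishingOrder_eq_top.2 h)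
  have hf : Function.Injective f := by
    obtain ⟨y, hy⟩ := hμ0.exists
    intro i j hij
    by_contra hne
    exact hy (Matrix.det_zero_of_row_eq hne (by funext l; simp [hij]))
  -- the complement of the rows of the minor
  obtain ⟨e, he, hfe⟩ : ∃ e : Fin p → Fin A.rank, Function.Injective e ∧
      Set.range e = (Set.range f)ᶜ := by
    classical
    have hc : Fintype.card {j // j ∈ (Set.range f)ᶜ} = p := by
      change Fintype.card {j // ¬ j ∈ Set.range f} = p
      rw [Fintype.card_subtype_compl (· ∈ Set.range f), Fintype.card_fin]
      have : Fintype.card {j // j ∈ Set.range f} = r := by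
        rw [← Nat.card_eq_fintype_card]
        exact (Nat.card_range_of_injective hf).trans (Nat.card_fin r)
      omega
    let E := (Fintype.equivFinOfCardEq hc).symm
    refine ⟨fun j => E j, Subtype.val_injective.comp E.injective, ?_⟩
    rw [show (fun j => (E j : Fin A.rank)) = Subtype.val ∘ E from rfl, E.surjective.range_comp,
      Subtype.range_coe]
  -- The Cramer coefficients: row `i` of the minor is replaced by the row of `e j`, and minimality
  -- of the order makes the quotient holomorphic.
  choose c hc using fun (i : Fin r) (j : Fin p) => exists_holomorphic_quotient
    (hμ (Function.update f i (e j)) g) (hμ f g) htop (hmin _ _)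
  have hall : ∀ᶠ y in 𝓝 x₀, (y ∈ U ∧ y ∈ L.coordNhd x₀) ∧ (y ≠ x₀ → μ f g y ≠ 0) ∧
      ∀ i j, ContMDiffAt 𝓘(ℂ) 𝓘(ℂ) ω (c i j) y ∧
        μ (Function.update f i (e j)) g y = c i j y * μ f g y :=
    hnear.and ((eventually_nhdsWithin_iff.1 hμ0).and
      (Filter.eventually_all.2 fun i => Filter.eventually_all.2 fun j => hc i j))
  obtain ⟨O, hO, hOo, hxO⟩ := eventually_nhds_iff.1 hall
  have haO := ha.mono hOo fun y hy => (hO y hy).1.1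
  have hbO := hb.mono hOo fun y hy => (hO y hy).1.1
  let k : Fin p → ∀ y, Q.V.Fiber y := fun j y => a (e j) y - ∑ i, c i j y • a (f i) y
  have hk : ∀ j, Q.V.IsHolSection (k j) O := fun j =>
    ContMDiffOn.sub_section (haO.isHolSection (e j)) (IsHolSection.sum fun i =>
      IsHolSection.smul (fun y hy => ((hO y hy).2.2 i j).1.contMDiffWithinAt)
        (haO.isHolSection (f i)))
  have hkA : ∀ y ∈ O, ∀ j, k j y ∈ A.carrier y := fun y hy j =>
    Submodule.sub_mem _ (haO.mem hy _)
      (Submodule.sum_mem _ fun i _ => Submodule.smul_mem _ _ (haO.mem hy _))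
  have hkill' : ∀ y ∈ O, y ≠ x₀ → ∀ j, ∀ w ∈ B.carrier y, Q.γ y (k j y) w = 0 := by
    intro y hy hyx j w hw
    obtain ⟨⟨-, hyc⟩, h0, hquot⟩ := hO y hy
    refine pairing_eq_zero_of_minor (hmax y) (v := fun i => a (f i) y) (w := fun i => b (g i) y)
      (l := (EuclideanSpace.proj (𝕜 := ℂ) (0 : Fin 1)).toLinearMap.comp (L.coord x₀ y))
      (fun z hz => coord_line_eq_zero hyc hz) (fun i => haO.mem hy _) (fun i => hbO.mem hy _)
      (h0 hyx) (hkA y hy j) (fun l => coord_line_eq_zero hyc ?_) hw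
    -- Cramer's rule shows that `k j` pairs to zero with the columns of the minor; as no minor of
    -- size `r + 1` survives, it then pairs to zero with all of `B`.
    have hcr := sum_det_updateRow_mul (Matrix.of fun i l => m y (f i) (g l))
      (fun l => m y (e j) (g l)) l
    have hup : ∀ i, ((Matrix.of fun i l => m y (f i) (g l)).updateRow i
        (fun l => m y (e j) (g l))).det = c i j y * μ f g y := by
      intro i
      rw [← (hquot i j).2]
      congr 1
      ext s t
      by_cases hs : s = i
      · subst hs
        simp
      · simp [hs]
    simp only [hup, Matrix.of_apply] at hcr
    have hcr' : ∑ i, c i j y * m y (f i) (g l) = m y (e j) (g l) := by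
      apply mul_left_cancel₀ (h0 hyx)
      rw [Finset.mul_sum]
      refine Eq.trans (Finset.sum_congr rfl fun i _ => ?_) hcr
      ring
    have : L.coord x₀ y (Q.γ y (k j y) (b (g l) y)) 0 =
        m y (e j) (g l) - ∑ i, c i j y * m y (f i) (g l) := by
      simp [k, m, pairingMatrix]
    rw [this, hcr', sub_self]
  have hkill : ∀ y ∈ O, ∀ j, ∀ w ∈ B.carrier y, Q.γ y (k j y) w = 0 := by
    intro y hy j
    by_cases hyx : y = x₀
    · subst hyx
      have hzero : ∀ l, Q.γ y (k j y) (b l y) = 0 := by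
        intro l
        have hhol := (Q.holomorphic O (k j) (b l) hOo (hk j)
          (hbO.isHolSection l)).contMDiffAt_coord_apply hOo hxO hxc 0
        have hz : ∀ᶠ x in 𝓝[≠] y, L.coord y x (Q.γ x (k j x) (b l x)) 0 = 0 := by
          filter_upwards [self_mem_nhdsWithin, nhdsWithin_le_nhds (hOo.mem_nhds hxO)] with x h1 h2
          -- The pairing is a holomorphic function vanishing off the centre, hence also there.
          rw [hkill' x h2 h1 j _ (hbO.mem h2 l)]
          simp
        have := (eventually_eq_zero_or_ne_zero hhol).resolve_right fun h => by
          obtain ⟨x, h1, h2⟩ := (hz.and h).exists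
          exact h2 h1
        exact coord_line_eq_zero hxc this.self_of_nhds
      intro w hw
      rw [← hbO.span_eq y hy, Submodule.mem_span_range_iff_exists_fun] at hw
      obtain ⟨d, rfl⟩ := hw
      simp [hzero]
    · exact hkill' y hy hyx j
  have hli : ∀ y ∈ O, LinearIndependent ℂ fun j => k j y := fun y hy =>
    linearIndependent_sub_combination (haO.linearIndependent y hy) he hfe fun i j => c i j y
  have hspan : ∀ y ∈ O, y ≠ x₀ → ∀ v ∈ A.carrier y, (∀ w ∈ B.carrier y, Q.γ y v w = 0) →
      v ∈ Submodule.span ℂ (Set.range fun j => k j y) := by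
    intro y hy hyx v hv hvB
    rw [← haO.span_eq y hy] at hv
    obtain ⟨s, hs, t, ht, rfl⟩ := Submodule.mem_sup.1
      (span_le_sup_sub_combination (a := fun l => a l y) hfe (fun i j => c i j y) hv)
    obtain ⟨d, rfl⟩ := (Submodule.mem_span_range_iff_exists_fun ℂ).1 ht
    have hs0 : ∀ w ∈ B.carrier y, Q.γ y s w = 0 := by
      obtain ⟨d', rfl⟩ := (Submodule.mem_span_range_iff_exists_fun ℂ).1 hs
      intro w hw
      have hkw : ∀ j, Q.γ y (a (e j) y - ∑ i, c i j y • a (f i) y) w = 0 :=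
        fun j => hkill y hy j w hw
      rw [map_sum, LinearMap.sum_apply]
      exact Finset.sum_eq_zero fun j _ => by rw [map_smul, LinearMap.smul_apply, hkw, smul_zero]
    -- The component along the rows of the minor pairs to zero with its columns, and the minor is
    -- invertible.
    have hd : d = 0 := by
      refine Matrix.eq_zero_of_vecMul_eq_zero ((hO y hy).2.1 hyx) ?_
      funext l
      have h1 := hvB (b (g l) y) (hbO.mem hy _)
      rw [map_add, LinearMap.add_apply, hs0 _ (hbO.mem hy _), zero_add] at h1
      have h2 := congrArg (fun z => L.coord x₀ y z 0) h1
      simpa [Matrix.vecMul, dotProduct, m, pairingMatrix] using h2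
    simpa [hd] using hs
  refine ⟨O, hxO, k, hOo, hk, hli, fun y hy => le_antisymm ?_ ?_⟩
  · rw [Submodule.span_le]
    rintro _ ⟨j, rfl⟩
    exact ⟨O, k j, hOo, hy, hk j, fun x hx => ⟨hkA x hx j, hkill x hx j⟩, rfl⟩
  · rintro _ ⟨U', s, hU', hyU', hs, h, rfl⟩
    by_cases hyx : y = x₀
    · subst hyx
      by_contra hnot
      -- At the centre the pointwise kernel may be too large. But a section of the kernel leaving
      -- the span of the frame there would, independence being open, leave it at nearby points,
      -- where the frame spans the pointwise kernel.
      let S : Fin (p + 1) → ∀ x, Q.V.Fiber x := fun i x => Fin.cons (α := fun _ => Q.V.Fiber x)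
        (s x) (fun j => k j x) i
      have hS : ∀ i, Q.V.IsHolSection (S i) (O ∩ U') := by
        refine Fin.cases ?_ fun j => ?_
        · exact hs.mono Set.inter_subset_right
        · exact (hk j).mono Set.inter_subset_left
      have hSl : LinearIndependent ℂ fun i => S i y :=
        linearIndependent_finCons.2 ⟨hli y hy, hnot⟩
      have hev := eventually_linearIndependent (hOo.inter hU') hS ⟨hxO, hyU'⟩ hSl
      obtain ⟨x, ⟨h1, h2⟩, h3⟩ := ((Filter.Eventually.and (hev.filter_mono nhdsWithin_le_nhds)
        (nhdsWithin_le_nhds ((hOo.inter hU').mem_nhds ⟨hxO, hyU'⟩))).and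
          (self_mem_nhdsWithin (a := y) (s := {y}ᶜ))).exists
      exact (linearIndependent_finCons.1 h1).2 (hspan x h2.1 h3 _ (h x h2.2).1 (h x h2.2).2)
    · exact hspan y hy hyx _ (h y hyU').1 (h y hyU').2

/-- The kernel of a pairing of generic rank `r` is a subbundle of corank `r`. -/
theorem exists_kernel_subbundle (hgen : ∀ x, ∀ᶠ y in 𝓝[≠] x, Q.HasRank A B r y)
    (hmax : ∀ y, ¬ Q.HasRank A B (r + 1) y) (hr : r ≤ A.rank) :
    ∃ K : Q.V.Subbundle, K.rank + r = A.rank ∧ (∀ x, K.carrier x ≤ A.carrier x) ∧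
      Q.Annihilates K B ∧ ∀ C : Q.V.Subbundle, (∀ x, C.carrier x ≤ A.carrier x) →
        Q.Annihilates C B → ∀ x, C.carrier x ≤ K.carrier x :=
  ⟨⟨Q.kernelFiber A B, A.rank - r, fun x =>
      exists_kernel_frame hgen hmax (Nat.sub_add_cancel hr) x⟩, Nat.sub_add_cancel hr,
    kernelFiber_le, fun _ _ hv _ hw => pairing_kernelFiber hv hw,
    fun _ hC h x => le_kernelFiber hC h x⟩

end QuadricBundle

/-! ### Radicals and orthogonals -/

namespace QuadricBundle

open HolVectorBundle

variable {X : Type*} [TopologicalSpace X] [ChartedSpace ℂ X] {n : ℕ} {L : HolVectorBundle X 1}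
  {Q : QuadricBundle L n} {A B : Q.V.Subbundle}

theorem Annihilates.symm (h : Q.Annihilates A B) : Q.Annihilates B A :=
  fun x v hv w hw => (Q.symm x v w).trans (h x w hw v hv)

theorem Annihilates.mono {A' B' : Q.V.Subbundle} (h : Q.Annihilates A B)
    (hA : ∀ x, A'.carrier x ≤ A.carrier x) (hB : ∀ x, B'.carrier x ≤ B.carrier x) :
    Q.Annihilates A' B' :=
  fun x v hv w hw => h x v (hA x hv) w (hB x hw)

theorem rank_mono [Nonempty X] (h : ∀ x, A.carrier x ≤ B.carrier x) : A.rank ≤ B.rank := by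
  obtain ⟨x⟩ := ‹Nonempty X›
  rw [← A.finrank_carrier x, ← B.finrank_carrier x]
  exact Submodule.finrank_mono (h x)

theorem le_of_rank_le (h : ∀ x, A.carrier x ≤ B.carrier x) (hr : B.rank ≤ A.rank) (x : X) :
    B.carrier x ≤ A.carrier x := by
  refine (Submodule.eq_of_le_of_finrank_le (h x) ?_).ge
  rwa [A.finrank_carrier, B.finrank_carrier]

variable [IsManifold 𝓘(ℂ) ω X] [T2Space X] [CompactSpace X]

theorem degree_eq_zero_of_rank_eq_zero {V : HolVectorBundle X n} (A : V.Subbundle)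
    (h : A.rank = 0) : A.degree = 0 := by
  have h1 : ∀ (g : V.HermitianMetric) p, A.chernForm g p = fun _ => 0 := by
    intro g p
    funext z
    have : IsEmpty (Fin A.rank) := h ▸ inferInstanceAs (IsEmpty (Fin 0))
    simp [Subbundle.chernForm, HermitianMetric.gramDet, InnerProductSpace.laplacian_const]
  simp [Subbundle.degree, surfaceIntegral, h1]

variable [ConnectedSpace X]

/-- The kernel of the restriction of `γ` to `A`. -/
theorem exists_radical (Q : QuadricBundle L n) (A : Q.V.Subbundle) :
    ∃ (K : Q.V.Subbundle) (r : ℕ), K.rank + r = A.rank ∧ (∀ x, K.carrier x ≤ A.carrier x) ∧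
      Q.Annihilates K A ∧ (∀ C : Q.V.Subbundle, (∀ x, C.carrier x ≤ A.carrier x) →
        Q.Annihilates C A → ∀ x, C.carrier x ≤ K.carrier x) ∧
      2 * (A.degree - K.degree) ≤ r * L.degree := by
  obtain ⟨r, hgen, hmax⟩ := exists_generic_rank Q A A
  obtain ⟨x⟩ : Nonempty X := inferInstance
  have := punctured_nhds_neBot x
  obtain ⟨y, hy⟩ := (hgen x).exists
  obtain ⟨K, hr, hKA, hK, hu⟩ := exists_kernel_subbundle hgen hmax hy.le_rank
  refine ⟨K, r, hr, hKA, hK, hu, ?_⟩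
  -- By symmetry of `γ` the radical serves as kernel on both sides, whence the factor `2`.
  have := degree_add_degree_le hKA hKA hr hr hK hK.symm hgen
  linarith

/-- The orthogonal of `A` for a generically nondegenerate `γ`. -/
theorem exists_orthogonal (hQ : ∀ C : Q.V.Subbundle, Q.Annihilates C Q.V.whole → C.rank = 0)
    (A : Q.V.Subbundle) :
    ∃ P : Q.V.Subbundle, P.rank + A.rank = n ∧ Q.Annihilates A P ∧
      (∀ C, Q.Annihilates A C → ∀ x, C.carrier x ≤ P.carrier x) ∧
      A.degree + Q.V.degree - P.degree ≤ A.rank * L.degree := by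
  obtain ⟨r, hgen, hmax⟩ := exists_generic_rank Q A Q.V.whole
  obtain ⟨x⟩ : Nonempty X := inferInstance
  have := punctured_nhds_neBot x
  obtain ⟨y, hy⟩ := (hgen x).exists
  obtain ⟨K, hr, hKA, hK, -⟩ := exists_kernel_subbundle hgen hmax hy.le_rank
  obtain ⟨P, hr', hPV, hP, hPu⟩ := exists_kernel_subbundle
    (fun x => (hgen x).mono fun _ h => h.symm) (fun y h => hmax y h.symm) hy.symm.le_rank
  have hK0 := hQ K hK
  -- The kernel of the pairing on the side of `A` annihilates all of `V`, so it is zero and the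
  -- pairing has full rank.
  obtain rfl : r = A.rank := by omega
  refine ⟨P, hr', hP.symm, fun C hC => hPu C (fun _ => le_top) hC.symm, ?_⟩
  have := degree_add_degree_le hKA hPV hr hr' hK hP.symm hgen
  rw [degree_eq_zero_of_rank_eq_zero K hK0] at this
  change A.degree + Q.V.whole.degree - P.degree ≤ _
  linarith

/-! ### Slope bounds from semistability -/

variable {α : ℝ}

/-- The orthogonal `P` of `A` contains `B`, so `A ⊂ P` is an admissible filtration with ranks adding
up to `n`. Its inequality reads `deg A + deg P ≤ deg V`; added to the degree inequality for the
pairing of `A` with `V / P`, it eliminates `deg P`. -/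
theorem IsSemistable.two_mul_degree_le_of_isotropic (hα : Q.IsSemistable α)
    (hQ : ∀ C : Q.V.Subbundle, Q.Annihilates C Q.V.whole → C.rank = 0) (hA0 : 0 < A.rank)
    (hAB : Q.Annihilates A B) (hle : ∀ x, A.carrier x ≤ B.carrier x) (hB : ¬ Q.Annihilates B B) :
    2 * A.degree ≤ A.rank * L.degree := by
  obtain ⟨P, hP, hAP, hu, hdeg⟩ := exists_orthogonal hQ A
  have hBP := hu B hAB
  have hAP' := fun x => (hle x).trans (hBP x)
  have hPP : ¬ Q.Annihilates P P := fun h => hB (h.mono hBP hBP)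
  -- Equal ranks would give `P = A`, which is isotropic, whereas `P` contains `B`.
  have hlt : A.rank < P.rank := by
    by_contra h
    have hPA := le_of_rank_le hAP' (not_lt.1 h)
    exact hPP (hAP.mono hPA fun _ => le_rfl)
  have := hα.filtration A P ⟨hA0, hAP', hlt, by omega, hAP, hPP⟩
  have hc : (A.rank : ℝ) + P.rank - n = 0 := by
    have : (P.rank : ℝ) + A.rank = n := by exact_mod_cast hP
    linarith
  rw [hc] at this
  linarith

/-- The form on `A` modulo its radical bounds the degree of the quotient; the radical is isotropic
and orthogonal to the nonisotropic `A`, so the previous bound applies to it. -/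
theorem IsSemistable.two_mul_degree_le (hα : Q.IsSemistable α)
    (hQ : ∀ C : Q.V.Subbundle, Q.Annihilates C Q.V.whole → C.rank = 0)
    (hA : ¬ Q.Annihilates A A) : 2 * A.degree ≤ A.rank * L.degree := by
  obtain ⟨K, s, hs, hKA, hK, -, hdeg⟩ := exists_radical Q A
  have hKd : 2 * K.degree ≤ K.rank * L.degree := by
    rcases Nat.eq_zero_or_pos K.rank with h0 | h0
    · simp [degree_eq_zero_of_rank_eq_zero K h0, h0]
    · exact hα.two_mul_degree_le_of_isotropic hQ h0 hK hKA hA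
  rw [← hs]
  push_cast
  linarith

/-- Each case yields `k α ≥ deg V - (n - k) deg L / 2` with an integer `k ≥ 1`. If the radical `R`
is nonzero, `k` is its rank and the attained equality plays no role; otherwise `k` is the absolute
value of the coefficient of `α` in the equality (doubled in the isotropic case). -/
theorem IsSemistable.le_of_attainsEquality (hα : Q.IsSemistable α) (he : Q.AttainsEquality α)
    (hd : Q.V.degree ≤ n / 2 * L.degree) :
    Q.V.degree - (n - 1) / 2 * L.degree ≤ α := by
  obtain ⟨R, r, hr, -, hR, hu, hdeg⟩ := exists_radical Q Q.V.whole
  change R.rank + r = n at hr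
  change 2 * (Q.V.degree - _) ≤ _ at hdeg
  rcases Nat.eq_zero_or_pos R.rank with hR0 | hR0
  · have hQ : ∀ C : Q.V.Subbundle, Q.Annihilates C Q.V.whole → C.rank = 0 := fun C hC =>
      Nat.le_zero.1 (hR0 ▸ rank_mono (hu C (fun _ => le_top) hC))
    by_contra h
    rw [not_le] at h
    have hcast : ∀ {a b : ℕ}, a < b → (a : ℝ) + 1 ≤ b := fun h => by exact_mod_cast h
    cases he with
    | nonisotropic A hA hγ he =>
      have h1 := hα.two_mul_degree_le hQ hγ
      have h2 := hcast hA.2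
      nlinarith
    | isotropic A hA hγ hne he =>
      obtain ⟨P, hP, hAP, hu, -⟩ := exists_orthogonal hQ A
      have hle := hu A hγ
      have hr := rank_mono hle
      -- An isotropic `P` would lie in its own orthogonal, of rank `rk A`. Since `A ⊆ P`, the ranks
      -- would agree and `2 rk A = n`, the case excluded because `α` then drops out.
      have hPP : ¬ Q.Annihilates P P := fun hPP => by
        obtain ⟨P', hP', hPP', hu', -⟩ := exists_orthogonal hQ P
        have := rank_mono (hu' P hPP)
        omega
      have h1 := hα.two_mul_degree_le_of_isotropic hQ hA.1 hAP hle hPP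
      have h2 : 2 * (A.rank : ℝ) + 1 ≤ n := by exact_mod_cast (by omega : 2 * A.rank < n)
      nlinarith
    | kernel A hA hγ he =>
      have := hQ A fun x v hv w _ => by rw [hγ x v hv, LinearMap.zero_apply]
      have := hA.1
      omega
    | filtration A B hAB hne he =>
      obtain ⟨P, hP, hAP, hu, -⟩ := exists_orthogonal hQ A
      have hr := rank_mono (hu B hAB.annihilates)
      have h1 := hα.two_mul_degree_le_of_isotropic hQ hAB.pos hAB.annihilates hAB.le
        hAB.not_annihilates
      have h2 := hα.two_mul_degree_le hQ hAB.not_annihilates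
      -- `B` lies in the orthogonal of `A`, so the ranks add up to at most `n`; equality is excluded
      -- by the nonzero coefficient of `α`.
      have h3 : (A.rank : ℝ) + B.rank + 1 ≤ n := by
        exact_mod_cast (by omega : A.rank + B.rank < n)
      nlinarith
  · have hr0 : 0 < r := by
      by_contra h
      -- If the generic rank were zero, the radical would be all of `V` and `γ` would vanish.
      obtain ⟨x, hx⟩ := Q.ne_zero
      refine hx (LinearMap.ext₂ fun v w => hR x v ?_ w trivial)
      exact le_of_rank_le (B := Q.V.whole) (fun _ => le_top) (by change n ≤ _; omega) x trivial
    have h1 := hα.kernel R ⟨hR0, by omega⟩ fun x v hv =>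
      LinearMap.ext fun w => hR x v hv w trivial
    have h2 : (R.rank : ℝ) = n - r := by
      have : (R.rank : ℝ) + r = n := by exact_mod_cast hr
      linarith
    have h3 : (1 : ℝ) ≤ r := by exact_mod_cast hr0
    have h4 : (1 : ℝ) ≤ R.rank := by exact_mod_cast hR0
    by_contra h
    rw [not_le] at h
    -- This is the term `(k - 1) (n deg L / 2 - deg V)`, where the bound on the degree of `V`
    -- enters.
    have h5 : 0 ≤ ((R.rank : ℝ) - 1) * (n / 2 * L.degree - Q.V.degree) :=
      mul_nonneg (by linarith) (by linarith)
    have h6 := mul_lt_mul_of_pos_right h (by linarith : (0 : ℝ) < R.rank)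
    rw [h2] at h1 h5 h6
    linarith

end QuadricBundle

end

/-- Every critical value lies between `α_m = d - (n - 1) / 2 * deg L` and `α_M = d / n`. -/
theorem mainTheorem4 {X : Type*} [TopologicalSpace X] [T2Space X] [CompactSpace X]
    [ConnectedSpace X] [ChartedSpace ℂ X] [IsManifold 𝓘(ℂ) ω X]
    (L : HolVectorBundle X 1) (n : ℕ) (hn : 1 ≤ n) (d : ℤ)
    (hd : (d : ℝ) ≤ n / 2 * L.degree) (α : ℝ)
    (hα : QuadricBundle.IsCriticalValue L n d α) :
    (d : ℝ) - (n - 1) / 2 * L.degree ≤ α ∧ α ≤ d / n := by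
  obtain ⟨h1, rfl | ⟨Q, hQ, hs, he⟩⟩ := hα
  · refine ⟨?_, h1⟩
    have hn' : (1 : ℝ) ≤ n := by exact_mod_cast hn
    rw [le_div_iff₀ (by linarith)]
    linarith [mul_nonneg (sub_nonneg.2 hn') (sub_nonneg.2 hd)]
  · rw [← hQ] at hd ⊢
    exact ⟨hs.le_of_attainsEquality he hd, hQ ▸ h1⟩
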